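/- **Model.** Let $E<E_0$, $\Delta=E_0-E>0$, $\beta>0$, and let $g\in L^2(\mathbb R^3)$ be a form factor. Let $\{\varphi_1,\varphi_2,\varphi_3\}$ be the standard basis of $\mathbb C^3$, $H_S(\sigma)=\mathrm{diag}(E_0,E+\sigma/2,E-\sigma/2)$, $G=\begin{pmatrix}0&1&1\\1&0&0\\1&0&0\end{pmatrix}$, $\rho_{S,\beta,\sigma}=e^{-\beta H_S(\sigma)}/Z_\sigma$ with $Z_\sigma=\mathrm{Tr}\,e^{-\beta H_S(\sigma)}$. In spherical coordinates the spectral density of the reservoir is $$J(\omega)=\frac{\pi}{2}\,\omega^2\int_{S^2}|g(\omega,\Sigma)|^2\,d\Sigma ,\qquad \widetilde J(0)=\lim_{\omega\to0_+}\frac{J(\omega)}{\omega}.$$ **Liouville operator.** On $\mathbb C^3\otimes\mathbb C^3\otimes\mathcal F$, where $\mathcal F$ is the symmetric Fock space over $L^2(\mathbb R\times S^2,du\,d\Sigma)$ with vacuum $\Omega$, let $$L(\sigma,\lambda)=H_S(\sigma)\otimes 1-1\otimes H_S(\sigma)+L_R+\lambda I,\qquad L_R=d\Gamma(u),$$ $$I=G\otimes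 1\otimes\varphi(g_\beta)-1\otimes G\otimes J_Re^{-\beta L_R/2}\varphi(g_\beta)J_Re^{-\beta L_R/2},$$ with $\varphi(f)=(a^*(f)+a(f))/\sqrt2$, $g_\beta(u,\Sigma)=\sqrt{\tfrac{u}{1-e^{-\beta u}}}\,|u|^{1/2}\,g(u,\Sigma)$ for $u\ge0$ and $g_\beta(u,\Sigma)=-\sqrt{\tfrac{u}{1-e^{-\beta u}}}\,|u|^{1/2}\,\overline{g(-u,\Sigma)}$ for $u<0$, and $(J_R\Psi)_n(u_1,\Sigma_1,\dots,u_n,\Sigma_n)=(-1)^n\,\overline{\Psi_n(-u_1,\Sigma_1,\dots,-u_n,\Sigma_n)}$. **Level shift operators and the dynamics $T_t$.** For $e\in\{0,\Delta,-\Delta\}$ let $P_e$ be the projection onto the eigenspace of $H_S(0)\otimes1-1\otimes H_S(0)$ with eigenvalue $e$, tensored with $|\Omega\rangle\langle\Omega|$, let $\overline P_e=1-P_e$, and $$\Lambda_e=\lim_{\epsilon\to0_+}P_e\Big(L(\sigma,\lambda)-L(\sigma,\lambda)\overline P_e\big(L(0,0)-e+i\epsilon\big)^{-1}\overline P_eL(\sigma,\lambda)\Big)P_e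 ,$$ viewed as an operator on $\mathbb C^3\otimes\mathbb C^3$. Let $U(t)=e^{it(\Lambda_0+\Lambda_\Delta+\Lambda_{-\Delta})}$, which is $\sum_{j,s}e^{it\varepsilon_j^{(s)}}P_j^{(s)}$ in terms of the eigenvalues and eigenprojections of the $\Lambda_e$ when these are diagonalizable. For a $3\times3$ matrix $A$ let $\alpha_t(A)$ be the matrix with $U(t)(A\otimes1)\psi_{\rm ref}=(\alpha_t(A)\otimes1)\psi_{\rm ref}$, $\psi_{\rm ref}=3^{-1/2}\sum_j\varphi_j\otimes\varphi_j$. Let $X_\sigma=\sqrt{Z_0/Z_\sigma}\;\mathrm{diag}(1,e^{-\beta\sigma/4},e^{\beta\sigma/4})$. The approximate reduced dynamics $T_t$ is defined by $$\mathrm{Tr}\big(T_t(\rho)A\big)=\mathrm{Tr}\big(\rho\,\alpha_t(X_\sigma AX_\sigma)\big)\quad\text{for all }A .$$ **Proposition 4 (Unique final state).** Assume that $J$ is differentiable at $\Delta$ and that the limit $\widetilde J(0)$ exists, and suppose that $J(\Delta)>0$ and $\widetilde J(0)>0$. Then the limits that define the level shift operators exist for all real $\sigma,\lambda$. Moreover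 there are constants $\lambda_0,\kappa>0$ and $C,c>0$, depending only on $E_0,E,\beta,g$ (in particular, independent of $\sigma$ and $\lambda$), such that for all $\lambda$ with $0<|\lambda|<\lambda_0$, all $\sigma$ with $0<\sigma<\kappa\lambda^2$, and every density matrix $\rho$ on $\mathbb C^3$, $$\lim_{t\to\infty}T_t(\rho)=\rho_{S,\beta,\sigma} \qquad\text{and}\qquad \|T_t(\rho)-\rho_{S,\beta,\sigma}\|\le C\,e^{-ct\sigma^2/\lambda^2}\quad\text{for all }t\ge0,$$ where $\|\cdot\|$ is the trace norm. -/

import Mathlib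

open MeasureTheory Filter Topology
open scoped ComplexOrder

noncomputable section

namespace ThreeLevel

/-- The parameters of the model: the energies of the three-level system (`E₀` for the first level,
`E ± σ/2` for the other two), the inverse temperature `β`, and the form factor `g` on momentum
space. -/
structure Model where
  E₀ : ℝ
  E : ℝ
  β : ℝ
  g : EuclideanSpace ℝ (Fin 3) → ℂ

/-- The unit sphere of momentum space. -/
abbrev Sphere2 : Type := Metric.sphere (0 : EuclideanSpace ℝ (Fin 3)) 1

/-- The surface measure of the unit sphere (of total mass `4π`). -/
def surfaceMeasure : Measure Sphere2 :=
  (volume : Measure (EuclideanSpace ℝ (Fin 3))).toSphere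

/-- The one-particle configuration space `ℝ × S²` of the reservoir in the Liouville (GNS)
representation. -/
abbrev Mode : Type := ℝ × Sphere2

/-- The measure `du × dΣ`. -/
def modeMeasure : Measure Mode := (volume : Measure ℝ).prod surfaceMeasure

/-- Wave functions of the Liouville space `ℂ³ ⊗ ℂ³ ⊗ 𝓕`: a sequence of functions of `n` reservoir
variables in `ℝ × S²`, `n = 0, 1, 2, …`, with values in `ℂ³ ⊗ ℂ³`, the latter in coordinates with
respect to the basis `φ_j ⊗ φ_k`. The operators below are given by their usual formulas on wave
functions. They are applied only to vectors with finitely many particles, obtained from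
`ℂ³ ⊗ ℂ³ ⊗ Ω`. -/
abbrev WaveFunction : Type := (n : ℕ) → (Fin n → Mode) → Fin 3 × Fin 3 → ℂ

/-- The operator `M ⊗ 𝟙 ⊗ 𝟙`. -/
def leftAct (M : Matrix (Fin 3) (Fin 3) ℂ) (Ψ : WaveFunction) : WaveFunction :=
  fun n x p => ∑ a, M p.1 a * Ψ n x (a, p.2)

/-- The operator `𝟙 ⊗ M ⊗ 𝟙`. -/
def rightAct (M : Matrix (Fin 3) (Fin 3) ℂ) (Ψ : WaveFunction) : WaveFunction :=
  fun n x p => ∑ a, M p.2 a * Ψ n x (p.1, a)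

/-- The vector `φ_j ⊗ φ_k ⊗ Ω`, `q = (j, k)`. -/
def vacuumVector (q : Fin 3 × Fin 3) : WaveFunction :=
  fun n _ p => if n = 0 ∧ p = q then 1 else 0

/-- The bosonic creation operator `a*(f)`. -/
def creation (f : Mode → ℂ) (Ψ : WaveFunction) : WaveFunction
  | 0, _, _ => 0
  | n + 1, x, p => ((1 / √((n : ℝ) + 1) : ℝ) : ℂ) *
      ∑ j : Fin (n + 1), f (x j) * Ψ n (fun k => x (j.succAbove k)) p

/-- The bosonic annihilation operator `a(f)`. -/
def annihilation (f : Mode → ℂ) (Ψ : WaveFunction) : WaveFunction :=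
  fun n x p => ((√((n : ℝ) + 1) : ℝ) : ℂ) *
    ∫ y, (starRingEnd ℂ) (f y) * Ψ (n + 1) (Fin.cons y x : Fin (n + 1) → Mode) p ∂modeMeasure

/-- The field operator `φ(f) = (a*(f) + a(f)) / √2`. -/
def field (f : Mode → ℂ) (Ψ : WaveFunction) : WaveFunction :=
  fun n x p => ((1 / √2 : ℝ) : ℂ) * (creation f Ψ n x p + annihilation f Ψ n x p)

/-- The sum `u₁ + ⋯ + u_n` of the reservoir energies. -/
def totalEnergy {n : ℕ} (x : Fin n → Mode) : ℝ := ∑ j, (x j).1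

/-- The reservoir Liouville operator `L_R = dΓ(u)`. -/
def reservoirL (Ψ : WaveFunction) : WaveFunction :=
  fun n x p => (totalEnergy x : ℂ) * Ψ n x p

/-- The operator `exp(-β L_R / 2)`. -/
def thermalWeight (β : ℝ) (Ψ : WaveFunction) : WaveFunction :=
  fun n x p => (Real.exp (-β * totalEnergy x / 2) : ℂ) * Ψ n x p

/-- The modular conjugation `J_R`. The sign `-1` for each particle is the one that belongs to the
sign in `thermalFormFactor` below: together they give
`J_R exp(-β L_R / 2) φ(g_β) Ω = φ(g_β) Ω`. -/
def modularConj (Ψ : WaveFunction) : WaveFunction :=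
  fun n x p => (-1) ^ n * (starRingEnd ℂ) (Ψ n (fun j => (-(x j).1, (x j).2)) p)

/-- The interaction matrix `G` of the three-level system. -/
def couplingMatrix : Matrix (Fin 3) (Fin 3) ℂ :=
  !![0, 1, 1; 1, 0, 0; 1, 0, 0]

/-- The reference vector `ψ_ref = 3^{-1/2} ∑_j φ_j ⊗ φ_j` (the trace state). -/
def refVector : Fin 3 × Fin 3 → ℂ :=
  fun p => if p.1 = p.2 then ((1 / √3 : ℝ) : ℂ) else 0

/-- A density matrix of the three-level system. -/
def IsDensityMatrix (ρ : Matrix (Fin 3) (Fin 3) ℂ) : Prop :=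
  ρ.PosSemidef ∧ ρ.trace = 1

/-- The trace norm: the sum of the singular values. -/
def traceNorm (M : Matrix (Fin 3) (Fin 3) ℂ) : ℝ :=
  ∑ i, √((Matrix.isHermitian_conjTranspose_mul_self M).eigenvalues i)

namespace Model

variable (M : Model)

/-- The energy gap `Δ`. -/
def gap : ℝ := M.E₀ - M.E

/-- The energies of the three levels. -/
def levels (σ : ℝ) : Fin 3 → ℝ := ![M.E₀, M.E + σ / 2, M.E - σ / 2]

/-- The Hamiltonian `H_S(σ)` of the three-level system, in its eigenbasis `φ₁, φ₂, φ₃`. -/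
def systemH (σ : ℝ) : Matrix (Fin 3) (Fin 3) ℂ :=
  Matrix.diagonal fun j => (M.levels σ j : ℂ)

/-- The partition function `Tr exp(-β H_S(σ))`. -/
def partitionFunction (σ : ℝ) : ℝ :=
  (NormedSpace.exp (-(M.β : ℂ) • M.systemH σ)).trace.re

/-- The Gibbs state `exp(-β H_S(σ)) / Tr exp(-β H_S(σ))`. -/
def gibbs (σ : ℝ) : Matrix (Fin 3) (Fin 3) ℂ :=
  (NormedSpace.exp (-(M.β : ℂ) • M.systemH σ)).trace⁻¹ •
    NormedSpace.exp (-(M.β : ℂ) • M.systemH σ)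

/-- The spectral density `J(ω) = (π/2) ω² ∫_{S²} |g(ω, Σ)|² dΣ`, `ω ≥ 0`. -/
def spectralDensity (ω : ℝ) : ℝ :=
  Real.pi / 2 * ω ^ 2 *
    ∫ s : Sphere2, ‖M.g (ω • (s : EuclideanSpace ℝ (Fin 3)))‖ ^ 2 ∂surfaceMeasure

/-- The form factor `g_β` at positive temperature, a function on `ℝ × S²`. -/
def thermalFormFactor (x : Mode) : ℂ :=
  ((√(x.1 / (1 - Real.exp (-M.β * x.1))) * √|x.1| : ℝ) : ℂ) *
    if 0 ≤ x.1 then M.g (x.1 • (x.2 : EuclideanSpace ℝ (Fin 3)))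
    else -(starRingEnd ℂ) (M.g ((-x.1) • (x.2 : EuclideanSpace ℝ (Fin 3))))

/-- The operator `J_R exp(-β L_R / 2) φ(g_β) J_R exp(-β L_R / 2)`. -/
def conjField (Ψ : WaveFunction) : WaveFunction :=
  modularConj (thermalWeight M.β (field M.thermalFormFactor
    (modularConj (thermalWeight M.β Ψ))))

/-- The interaction operator
`I = G ⊗ 𝟙 ⊗ φ(g_β) - 𝟙 ⊗ G ⊗ J_R exp(-β L_R / 2) φ(g_β) J_R exp(-β L_R / 2)`. -/
def interaction (Ψ : WaveFunction) : WaveFunction :=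
  leftAct couplingMatrix (field M.thermalFormFactor Ψ) -
    rightAct couplingMatrix (M.conjField Ψ)

/-- The Liouville operator `L(σ, λ) = H_S(σ) ⊗ 𝟙 - 𝟙 ⊗ H_S(σ) + L_R + λ I`. -/
def liouville (σ lam : ℝ) (Ψ : WaveFunction) : WaveFunction :=
  leftAct (M.systemH σ) Ψ - rightAct (M.systemH σ) Ψ + reservoirL Ψ +
    (lam : ℂ) • M.interaction Ψ

/-- The eigenvalue of `L_S(0) = H_S(0) ⊗ 𝟙 - 𝟙 ⊗ H_S(0)` at the eigenvector `φ_j ⊗ φ_k`,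
`p = (j, k)`. -/
def bohr (p : Fin 3 × Fin 3) : ℝ := M.levels 0 p.1 - M.levels 0 p.2

open Classical in
/-- The projection `P_e` onto the eigenspace of `L_S(0)` with eigenvalue `e`, tensored with the
projection onto the vacuum. -/
def proj (e : ℝ) (Ψ : WaveFunction) : WaveFunction :=
  fun n x p => if n = 0 ∧ M.bohr p = e then Ψ n x p else 0

/-- The complementary projection `𝟙 - P_e`. -/
def coproj (e : ℝ) (Ψ : WaveFunction) : WaveFunction := Ψ - M.proj e Ψ

/-- The resolvent `(L(0, 0) - e + iε)⁻¹`. In the chosen coordinates `L(0, 0)` is the multiplication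
by `bohr p + u₁ + ⋯ + u_n`; it commutes with `P_e`. -/
def resolvent (e ε : ℝ) (Ψ : WaveFunction) : WaveFunction :=
  fun n x p => ((M.bohr p + totalEnergy x - e : ℝ) + Complex.I * ε : ℂ)⁻¹ * Ψ n x p

/-- The level shift operator at `ε > 0`, before the limit `ε → 0⁺` is taken:
`P_e (L - L (𝟙 - P_e) (L(0,0) - e + iε)⁻¹ (𝟙 - P_e) L) P_e`, `L = L(σ, λ)`, written as a matrix on
`ℂ³ ⊗ ℂ³` in the basis `φ_j ⊗ φ_k`, that is, extended by zero outside the range of `P_e`. -/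
def levelShiftReg (σ lam e ε : ℝ) : Matrix (Fin 3 × Fin 3) (Fin 3 × Fin 3) ℂ :=
  fun p q =>
    let Φ := M.liouville σ lam (M.proj e (vacuumVector q))
    M.proj e (Φ - M.liouville σ lam (M.coproj e (M.resolvent e ε (M.coproj e Φ)))) 0
      Fin.elim0 p

/-- The level shift operator `Λ_e`, the limit `ε → 0⁺`. -/
def levelShift (σ lam e : ℝ) : Matrix (Fin 3 × Fin 3) (Fin 3 × Fin 3) ℂ :=
  limUnder (𝓝[>] (0 : ℝ)) fun ε => M.levelShiftReg σ lam e ε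

/-- The sum of the level shift operators `Λ_e`, `e = 0, Δ, -Δ`. They act on the three mutually
orthogonal eigenspaces of `L_S(0)`, which span `ℂ³ ⊗ ℂ³`. -/
def totalLevelShift (σ lam : ℝ) : Matrix (Fin 3 × Fin 3) (Fin 3 × Fin 3) ℂ :=
  M.levelShift σ lam 0 + M.levelShift σ lam M.gap + M.levelShift σ lam (-M.gap)

/-- The evolution `U(t)` on `ℂ³ ⊗ ℂ³` generated by the level shift operators: it is `exp(i t Λ_e)`
on the eigenspace of `L_S(0)` with eigenvalue `e`. In terms of the eigenvalues and eigenprojections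
of the level shift operators it is `∑ exp(i t ε_s) P_s`, see `evolution_eq_sum`. -/
def evolution (σ lam t : ℝ) : Matrix (Fin 3 × Fin 3) (Fin 3 × Fin 3) ℂ :=
  NormedSpace.exp ((Complex.I * (t : ℂ)) • M.totalLevelShift σ lam)

/-- The Heisenberg evolution `α_t`, determined by
`U(t) (A ⊗ 𝟙) ψ_ref = (α_t(A) ⊗ 𝟙) ψ_ref`, see `evolution_mulVec_refVector`. The vector
`(A ⊗ 𝟙) ψ_ref` has the coordinates `3^{-1/2} A_{jk}`. -/
def heisenberg (σ lam t : ℝ) (A : Matrix (Fin 3) (Fin 3) ℂ) : Matrix (Fin 3) (Fin 3) ℂ :=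
  fun j k => (M.evolution σ lam t).mulVec (fun p => A p.1 p.2) (j, k)

/-- The positive matrix `X_σ` with `X_σ ρ_{S,β,0} X_σ = ρ_{S,β,σ}`. -/
def gibbsRatio (σ : ℝ) : Matrix (Fin 3) (Fin 3) ℂ :=
  (√(M.partitionFunction 0 / M.partitionFunction σ) : ℂ) •
    Matrix.diagonal ![1, (Real.exp (-M.β * σ / 4) : ℂ), (Real.exp (M.β * σ / 4) : ℂ)]

/-- The approximate reduced dynamics `T_t`: the matrix `T_t(ρ)` with
`Tr(T_t(ρ) A) = Tr(ρ α_t(X_σ A X_σ))` for all observables `A`, see `trace_approxDynamics_mul`. -/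
def approxDynamics (σ lam t : ℝ) (ρ : Matrix (Fin 3) (Fin 3) ℂ) : Matrix (Fin 3) (Fin 3) ℂ :=
  fun k l => (ρ * M.heisenberg σ lam t
    (M.gibbsRatio σ * Matrix.single l k 1 * M.gibbsRatio σ)).trace

/-- If the level shift operators are diagonalizable, with eigenvalues `ε_s` and eigenprojections
`P_s`, then `U(t) = ∑ exp(i t ε_s) P_s`. -/
theorem evolution_eq_sum {ι : Type} [Fintype ι] [DecidableEq ι] (σ lam t : ℝ) (ev : ι → ℂ)
    (P : ι → Matrix (Fin 3 × Fin 3) (Fin 3 × Fin 3) ℂ)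
    (hP : ∀ r s, P r * P s = if r = s then P r else 0) (hone : ∑ s, P s = 1)
    (hΛ : M.totalLevelShift σ lam = ∑ s, ev s • P s) :
    M.evolution σ lam t = ∑ s, Complex.exp (Complex.I * t * ev s) • P s := by
  let _ : NormedRing (Matrix (Fin 3 × Fin 3) (Fin 3 × Fin 3) ℂ) := Matrix.linftyOpNormedRing
  let _ : NormedAlgebra ℂ (Matrix (Fin 3 × Fin 3) (Fin 3 × Fin 3) ℂ) :=
    Matrix.linftyOpNormedAlgebra
  let _ : NormedAlgebra ℚ (ι → ℂ) := NormedAlgebra.restrictScalars ℚ ℂ _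
  let f : (ι → ℂ) →+* Matrix (Fin 3 × Fin 3) (Fin 3 × Fin 3) ℂ :=
    { toFun := fun v => ∑ s, v s • P s
      map_one' := by simpa using hone
      map_zero' := by simp
      map_add' := fun v w => by simp [add_smul, Finset.sum_add_distrib]
      map_mul' := fun v w => by
        simp [Finset.sum_mul, Finset.mul_sum, hP, smul_smul, mul_comm] }
  have hf : Continuous f := by
    change Continuous fun v : ι → ℂ => ∑ s, v s • P s
    fun_prop
  have h := NormedSpace.map_exp f hf (fun s => Complex.I * t * ev s)
  have h1 : f (fun s => Complex.I * t * ev s) =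
      (Complex.I * (t : ℂ)) • M.totalLevelShift σ lam := by
    rw [hΛ, Finset.smul_sum]
    exact Finset.sum_congr rfl fun s _ => by rw [smul_smul]
  rw [evolution, ← h1]
  refine h.symm.trans ?_
  change ∑ s, NormedSpace.exp (fun s => Complex.I * t * ev s) s • P s = _
  refine Finset.sum_congr rfl fun s _ => ?_
  rw [Pi.coe_exp, Complex.exp_eq_exp_ℂ]

/-- The relation `U(t) (A ⊗ 𝟙) ψ_ref = (α_t(A) ⊗ 𝟙) ψ_ref`. -/
theorem evolution_mulVec_refVector (σ lam t : ℝ) (A : Matrix (Fin 3) (Fin 3) ℂ) :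
    (M.evolution σ lam t).mulVec (fun p => ∑ a, A p.1 a * refVector (a, p.2)) =
      fun p => ∑ a, M.heisenberg σ lam t A p.1 a * refVector (a, p.2) := by
  have h : ∀ (B : Matrix (Fin 3) (Fin 3) ℂ),
      (fun p : Fin 3 × Fin 3 => ∑ a, B p.1 a * refVector (a, p.2)) =
        ((1 / √3 : ℝ) : ℂ) • fun p : Fin 3 × Fin 3 => B p.1 p.2 := by
    intro B
    funext p
    simp only [refVector, mul_ite, mul_zero, Finset.sum_ite_eq', Finset.mem_univ, if_true,
      Pi.smul_apply, smul_eq_mul]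
    exact mul_comm _ _
  rw [h, h, Matrix.mulVec_smul]
  rfl

/-- The relation that determines `T_t(ρ)`. -/
theorem trace_approxDynamics_mul (σ lam t : ℝ) (ρ A : Matrix (Fin 3) (Fin 3) ℂ) :
    (M.approxDynamics σ lam t ρ * A).trace =
      (ρ * M.heisenberg σ lam t (M.gibbsRatio σ * A * M.gibbsRatio σ)).trace := by
  let F : Matrix (Fin 3) (Fin 3) ℂ →ₗ[ℂ] ℂ :=
    { toFun := fun B =>
        (ρ * M.heisenberg σ lam t (M.gibbsRatio σ * B * M.gibbsRatio σ)).trace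
      map_add' := fun B C => by
        have : M.heisenberg σ lam t
            (M.gibbsRatio σ * (B + C) * M.gibbsRatio σ) =
            M.heisenberg σ lam t (M.gibbsRatio σ * B * M.gibbsRatio σ) +
            M.heisenberg σ lam t (M.gibbsRatio σ * C * M.gibbsRatio σ) := by
          rw [Matrix.mul_add, Matrix.add_mul]
          ext j k
          exact congrFun (Matrix.mulVec_add (M.evolution σ lam t) _ _) (j, k)
        rw [this, Matrix.mul_add, Matrix.trace_add]
      map_smul' := fun c B => by
        have : M.heisenberg σ lam t
            (M.gibbsRatio σ * (c • B) * M.gibbsRatio σ) =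
            c • M.heisenberg σ lam t (M.gibbsRatio σ * B * M.gibbsRatio σ) := by
          rw [Matrix.mul_smul, Matrix.smul_mul]
          ext j k
          exact congrFun (Matrix.mulVec_smul (M.evolution σ lam t) c _) (j, k)
        rw [this, Matrix.mul_smul, Matrix.trace_smul]
        rfl }
  change _ = F A
  conv_rhs => rw [Matrix.matrix_eq_sum_single A]
  simp only [map_sum]
  have h : ∀ l k : Fin 3, F (Matrix.single l k (A l k)) =
      M.approxDynamics σ lam t ρ k l * A l k := by
    intro l k
    have : Matrix.single l k (A l k) = A l k • Matrix.single l k (1 : ℂ) := by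
      rw [Matrix.smul_single, smul_eq_mul, mul_one]
    rw [this, map_smul, smul_eq_mul, mul_comm]
    rfl
  simp only [h]
  rw [Finset.sum_comm]
  rfl

/-- The same relation in terms of a representing vector `ψ = (𝟙 ⊗ b) ψ_ref` of `ρ`, that is, with
`Tr(ρ A) = ⟨ψ, (A ⊗ 𝟙) ψ⟩`:
`Tr(T_t(ρ) A) = ⟨ψ, (𝟙 ⊗ b) U(t) (X_σ A X_σ ⊗ 𝟙) ψ_ref⟩`. -/
theorem trace_approxDynamics_mul_eq_inner (σ lam t : ℝ) (ρ A b : Matrix (Fin 3) (Fin 3) ℂ)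
    (ψ : Fin 3 × Fin 3 → ℂ) (hψ : ∀ p, ψ p = ∑ a, b p.2 a * refVector (p.1, a))
    (hρ : ∀ B : Matrix (Fin 3) (Fin 3) ℂ,
      (ρ * B).trace = ∑ p, (starRingEnd ℂ) (ψ p) * ∑ a, B p.1 a * ψ (a, p.2)) :
    (M.approxDynamics σ lam t ρ * A).trace =
      ∑ p, (starRingEnd ℂ) (ψ p) * ∑ a, b p.2 a *
        (M.evolution σ lam t).mulVec
          (fun q => ∑ c, (M.gibbsRatio σ * A * M.gibbsRatio σ) q.1 c * refVector (c, q.2))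
          (p.1, a) := by
  rw [trace_approxDynamics_mul, hρ, evolution_mulVec_refVector]
  refine Finset.sum_congr rfl fun p _ => ?_
  congr 1
  simp only [hψ, Finset.mul_sum]
  rw [Finset.sum_comm]
  exact Finset.sum_congr rfl fun a _ => Finset.sum_congr rfl fun c _ => by ring

end Model

end ThreeLevel

end

/-! To second order in λ the reservoir acts on the three levels only through boundary values, at the
Bohr frequencies ±Δ, of the Cauchy transform of the density
$u\mapsto\int_{S^2}|g_\beta(u,\Sigma)|^2d\Sigma$, because G has matrix elements only between the
upper level and the two lower ones. The boundary values exist by the Sokhotski-Plemelj formula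
(`exists_tendsto_cauchyTransform`): differentiability of J at Δ controls the singular point, and the
limit of J(ω)/ω makes the density integrable near u = 0. Their imaginary parts are -2γ and -2qγ with
γ = J(Δ)/(1 - exp(-βΔ)) > 0 and q = exp(-βΔ), which is detailed balance. Inserting them turns i(Λ_0
+ Λ_Δ + Λ_{-Δ}) into an explicit linear system (`isGenerator_of_boundary_values`).

In this system the coherences between the upper and the lower levels decay at rate 2γλ²
(`norm_le_of_coherence_equation`). In the remaining block G couples φ₁ only to the bright state φ₂ +
φ₃. At σ = 0 the population of the dark state φ₂ - φ₃ is therefore conserved and the final state is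
not unique; the splitting σ mixes bright and dark. Put s = σ/λ² and measure time in units of λ⁻².
The bright-dark coherences relax at rate 2qγ and follow the slow variable R, essentially the
difference of the dark and bright populations, as sηR and its conjugate analogue, where 4(qγ + iξ)η
= i and ξ is an energy shift. Fed back into the equation of R, this gives a decay rate proportional
to s² Im η with Im η > 0, that is, σ²/λ² in the original time. A weighted sum of squares of R and of
the deviations from the slow manifold is a Lyapunov function with constants uniform in s
(`exists_dissipation`, `exists_decay`).

The functional q u₀₀ + u₁₁ + u₂₂ is conserved, so every observable relaxes to its expectation in the
Gibbs state at σ = 0, times the identity. Conjugation by X_σ converts that expectation into the one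
in the Gibbs state at σ (`exists_approxDynamics_decay`). -/

noncomputable section

namespace ThreeLevel

/-! ### Cauchy transforms and the Sokhotski-Plemelj formula -/

/-- The regularised Cauchy transform of a real density. -/
def cauchyTransform (h : ℝ → ℝ) (a ε : ℝ) : ℂ :=
  ∫ u, (h u : ℂ) * (((u - a : ℝ) : ℂ) + Complex.I * ε)⁻¹

lemma norm_inv_add_I_mul_le_inv (x : ℝ) {ε : ℝ} (hε : 0 < ε) :
    ‖((x : ℂ) + Complex.I * ε)⁻¹‖ ≤ ε⁻¹ := by
  rw [norm_inv]
  gcongr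
  have := Complex.abs_im_le_norm ((x : ℂ) + Complex.I * ε)
  simpa [abs_of_pos hε] using this

lemma continuous_inv_add_I_mul (b : ℝ) {ε : ℝ} (hε : 0 < ε) :
    Continuous fun u : ℝ => (((u - b : ℝ) : ℂ) + Complex.I * ε)⁻¹ :=
  Continuous.inv₀ (by fun_prop) fun u hu => by
    have := congrArg Complex.im hu
    simp [hε.ne'] at this

/-- For ε > 0 the path u - a + iε stays in the upper half plane, where the principal logarithm is a
primitive. -/
lemma intervalIntegral_inv_sub_add_I (a : ℝ) {ε : ℝ} (hε : 0 < ε) :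
    ∫ u in (a - 1)..(a + 1), (((u - a : ℝ) : ℂ) + Complex.I * ε)⁻¹ =
      Complex.log (1 + Complex.I * ε) - Complex.log (-1 + Complex.I * ε) := by
  have hs : ∀ u : ℝ, (((u - a : ℝ) : ℂ) + Complex.I * ε) ∈ Complex.slitPlane := fun u =>
    Or.inr (by simpa using hε.ne')
  have hd : ∀ u ∈ Set.uIcc (a - 1) (a + 1),
      HasDerivAt (fun u : ℝ => Complex.log (((u - a : ℝ) : ℂ) + Complex.I * ε))
        (((u - a : ℝ) : ℂ) + Complex.I * ε)⁻¹ u := by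
    intro u _
    have h1 : HasDerivAt (fun u : ℝ => ((u - a : ℝ) : ℂ) + Complex.I * ε) 1 u := by
      simpa using (((hasDerivAt_id u).sub_const a).ofReal_comp).add_const (Complex.I * ε)
    simpa using h1.clog_real (hs u)
  rw [intervalIntegral.integral_eq_sub_of_hasDerivAt hd ((continuous_inv_add_I_mul a hε).intervalIntegrable _ _)]
  simp

/-- The point -1 + iε approaches the branch cut from above, so its logarithm tends to iπ. The
imaginary part in the Sokhotski-Plemelj formula comes from here. -/
lemma tendsto_log_sub_log :
    Tendsto (fun ε : ℝ => Complex.log (1 + Complex.I * ε) - Complex.log (-1 + Complex.I * ε))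
      (𝓝[>] 0) (𝓝 (-(Complex.I * Real.pi))) := by
  have h1 : Tendsto (fun ε : ℝ => Complex.log (1 + Complex.I * ε)) (𝓝[>] 0) (𝓝 0) := by
    have : ContinuousAt (fun ε : ℝ => Complex.log (1 + Complex.I * ε)) 0 :=
      ContinuousAt.clog (by fun_prop) (by simp)
    simpa using this.tendsto.mono_left nhdsWithin_le_nhds
  have h2 : Tendsto (fun ε : ℝ => Complex.log (-1 + Complex.I * ε)) (𝓝[>] 0)
      (𝓝 (Complex.I * Real.pi)) := by
    have h := Complex.tendsto_log_nhdsWithin_im_nonneg_of_re_neg_of_im_zero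
      (z := -1) (by simp) (by simp)
    have h3 : Tendsto (fun ε : ℝ => (-1 + Complex.I * ε : ℂ)) (𝓝[>] 0)
        (𝓝[{z : ℂ | 0 ≤ z.im}] (-1)) := by
      refine tendsto_nhdsWithin_iff.2 ⟨?_, ?_⟩
      · have : ContinuousAt (fun ε : ℝ => (-1 + Complex.I * ε : ℂ)) 0 := by fun_prop
        simpa using this.tendsto.mono_left nhdsWithin_le_nhds
      · filter_upwards [self_mem_nhdsWithin] with ε hε
        simpa using le_of_lt hε
    have h4 := h.comp h3
    simp only [norm_neg, norm_one, Real.log_one, Complex.ofReal_zero, zero_add] at h4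
    rw [mul_comm]
    exact h4
  simpa using h1.sub h2

/-- The Sokhotski-Plemelj formula for an integrable density, at a point of differentiability. -/
theorem exists_tendsto_cauchyTransform {h : ℝ → ℝ} (hint : Integrable h) {a : ℝ}
    (hd : DifferentiableAt ℝ h a) :
    ∃ x : ℝ, Tendsto (cauchyTransform h a) (𝓝[>] 0)
      (𝓝 ((x : ℂ) - Complex.I * (Real.pi * h a : ℝ))) := by
  -- Subtracting the constant h(a) on an interval centred at a leaves a remainder k for which
  -- k(u)/(u - a) is integrable; the subtracted part is an explicit logarithm.
  let χ : ℝ → ℝ := Set.indicator (Set.Ioc (a - 1) (a + 1)) fun _ => h a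
  let k : ℝ → ℝ := fun u => h u - χ u
  have hχ : Integrable χ := by
    refine (integrable_indicator_iff measurableSet_Ioc).2 ?_
    simp
  have hk : Integrable k := hint.sub hχ
  have hkd : Integrable fun u => |u - a|⁻¹ * k u := by
    obtain ⟨C, hC⟩ := hd.hasDerivAt.isBigO_sub.bound
    obtain ⟨δ, hδ, hb⟩ := Metric.eventually_nhds_iff.1 hC
    -- The bound r ≤ 1 keeps the ball inside the interval, so that k = h - h(a) there and the
    -- difference quotient is bounded. Outside the ball 1/|u - a| ≤ 1/r.
    set r := min δ 1 with hr
    have hr0 : 0 < r := lt_min hδ one_pos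
    have hdom : Integrable fun u => Set.indicator (Metric.ball a r) (fun _ => |C|) u + r⁻¹ * |k u| := by
      refine Integrable.add ?_ (hk.abs.const_mul _)
      refine (integrable_indicator_iff measurableSet_ball).2 ?_
      exact integrableOn_const measure_ball_lt_top.ne
    refine hdom.mono' ?_ (Eventually.of_forall fun u => ?_)
    · refine AEStronglyMeasurable.mul ?_ hk.aestronglyMeasurable
      exact Measurable.aestronglyMeasurable (by fun_prop)
    · rw [norm_mul, norm_inv, Real.norm_eq_abs, Real.norm_eq_abs, abs_abs]
      by_cases hu : u ∈ Metric.ball a r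
      · rw [Set.indicator_of_mem hu]
        have hu' : |u - a| < r := by simpa [Real.dist_eq] using hu
        have h1 : k u = h u - h a := by
          have : u ∈ Set.Ioc (a - 1) (a + 1) := by
            have := abs_lt.1 (hu'.trans_le (min_le_right δ 1))
            constructor <;> linarith
          simp only [k, χ, Set.indicator_of_mem this]
        have h2 := hb (y := u) (by rw [Real.dist_eq]; exact hu'.trans_le (min_le_left _ _))
        rw [← h1, Real.norm_eq_abs, Real.norm_eq_abs] at h2
        have h3 : |u - a|⁻¹ * |k u| ≤ |C| := by
          rcases eq_or_ne u a with rfl | hne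
          · simp
          · rw [inv_mul_le_iff₀ (abs_pos.2 (sub_ne_zero.2 hne)), mul_comm]
            exact h2.trans (by gcongr; exact le_abs_self C)
        have : 0 ≤ r⁻¹ * |k u| := by positivity
        linarith
      · rw [Set.indicator_of_notMem hu, zero_add]
        have hu' : r ≤ |u - a| := by simpa [Real.dist_eq] using hu
        gcongr
  refine ⟨∫ u, (u - a)⁻¹ * k u, ?_⟩
  have hlim : Tendsto (fun ε : ℝ => ∫ u, (k u : ℂ) * (((u - a : ℝ) : ℂ) + Complex.I * ε)⁻¹)
      (𝓝[>] 0) (𝓝 ((∫ u, (u - a)⁻¹ * k u : ℝ) : ℂ)) := by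
    rw [← integral_complex_ofReal]
    refine tendsto_integral_filter_of_dominated_convergence (fun u => ‖|u - a|⁻¹ * k u‖) ?_ ?_
      hkd.norm ?_
    · filter_upwards [self_mem_nhdsWithin] with ε hε
      exact hk.ofReal.aestronglyMeasurable.mul (continuous_inv_add_I_mul a hε).aestronglyMeasurable
    · refine Eventually.of_forall fun ε => ?_
      have : ∀ᵐ u : ℝ, u ≠ a := by simp [ae_iff]
      filter_upwards [this] with u hu
      rw [norm_mul, norm_mul, mul_comm, norm_inv, Complex.norm_real, norm_inv, norm_abs_eq_norm]
      gcongr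
      · simpa [sub_eq_zero] using hu
      · simpa using Complex.abs_re_le_norm (((u - a : ℝ) : ℂ) + Complex.I * ε)
    · have : ∀ᵐ u : ℝ, u ≠ a := by simp [ae_iff]
      filter_upwards [this] with u hu
      have h1 : ContinuousAt (fun ε : ℝ => (k u : ℂ) * (((u - a : ℝ) : ℂ) + Complex.I * ε)⁻¹) 0 := by
        refine continuousAt_const.mul (ContinuousAt.inv₀ (by fun_prop) ?_)
        simpa using Complex.ofReal_ne_zero.2 (sub_ne_zero.2 hu)
      have h2 := h1.tendsto.mono_left (nhdsWithin_le_nhds (s := Set.Ioi 0))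
      have h3 : (k u : ℂ) * (((u - a : ℝ) : ℂ) + Complex.I * (0 : ℝ))⁻¹ =
          ((u - a)⁻¹ * k u : ℝ) := by
        push_cast
        simp [mul_comm]
      rwa [h3] at h2
  have hadd := hlim.add ((tendsto_log_sub_log).const_mul (h a : ℂ))
  refine (hadd.congr' ?_).trans (le_of_eq ?_)
  · filter_upwards [self_mem_nhdsWithin] with ε hε
    have hb : ∀ {f : ℝ → ℝ}, Integrable f →
        Integrable fun u => (f u : ℂ) * (((u - a : ℝ) : ℂ) + Complex.I * ε)⁻¹ := fun hf =>
      hf.ofReal.mul_bdd (continuous_inv_add_I_mul a hε).aestronglyMeasurable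
        (Eventually.of_forall fun u => norm_inv_add_I_mul_le_inv _ hε)
    have h1 : (h a : ℂ) * (Complex.log (1 + Complex.I * ε) - Complex.log (-1 + Complex.I * ε)) =
        ∫ u, (χ u : ℂ) * (((u - a : ℝ) : ℂ) + Complex.I * ε)⁻¹ := by
      rw [← intervalIntegral_inv_sub_add_I a hε, intervalIntegral.integral_of_le (by linarith),
        ← integral_const_mul, ← integral_indicator measurableSet_Ioc]
      congr 1
      funext u
      by_cases hu : u ∈ Set.Ioc (a - 1) (a + 1) <;> simp [χ, hu]
    rw [h1, ← integral_add (hb hk) (hb hχ), cauchyTransform]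
    congr 1
    funext u
    simp only [k]
    push_cast
    ring
  · congr 1
    push_cast
    ring

/-! ### Spherical coordinates in momentum space -/

instance : IsFiniteMeasure surfaceMeasure := by
  unfold surfaceMeasure; infer_instance

instance : SigmaFinite (Measure.comap (Subtype.val : Set.Ioi (0 : ℝ) → ℝ) volume) := by
  refine SigmaFinite.of_map _ (f := Subtype.val) measurable_subtype_coe.aemeasurable ?_
  rw [(measurePreserving_subtype_coe measurableSet_Ioi).map_eq]
  infer_instance

/-- The point of momentum space with given spherical coordinates. -/
def ofSpherical (x : Mode) : EuclideanSpace ℝ (Fin 3) := x.1 • (x.2 : EuclideanSpace ℝ (Fin 3))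

lemma continuous_ofSpherical : Continuous ofSpherical := by
  unfold ofSpherical; fun_prop

/-- The product measure `du × dΣ` on `(0, ∞) × S²`. -/
def radialMeasure : Measure Mode := (volume.restrict (Set.Ioi (0 : ℝ))).prod surfaceMeasure

/-- The product of the subtype of positive radii and the sphere. -/
abbrev Polar : Type := Sphere2 × Set.Ioi (0 : ℝ)

/-- The inclusion of `S² × (0, ∞)` into `ℝ × S²`. -/
def Polar.toMode (x : Polar) : Mode := (x.2, x.1)

/-- The measure `dΣ × du` on `S² × (0, ∞)`. -/
def polarMeasure : Measure Polar :=
  surfaceMeasure.prod (Measure.comap Subtype.val (volume : Measure ℝ))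

lemma measurePreserving_toMode : MeasurePreserving Polar.toMode polarMeasure radialMeasure := by
  have h1 : MeasurePreserving (Subtype.val : Set.Ioi (0 : ℝ) → ℝ)
      (Measure.comap Subtype.val volume) (volume.restrict (Set.Ioi 0)) :=
    measurePreserving_subtype_coe measurableSet_Ioi
  have h2 := (MeasurePreserving.id surfaceMeasure).prod h1
  have h3 : MeasurePreserving Prod.swap (surfaceMeasure.prod (volume.restrict (Set.Ioi (0 : ℝ))))
    radialMeasure := Measure.measurePreserving_swap
  exact h3.comp h2

lemma measurableEmbedding_toMode : MeasurableEmbedding Polar.toMode := by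
  have h := (MeasurableEmbedding.subtype_coe (measurableSet_Ioi (a := (0 : ℝ))))
  have h2 : MeasurableEmbedding (Prod.map (id : Sphere2 → Sphere2) (Subtype.val : Set.Ioi (0:ℝ) → ℝ)) :=
    MeasurableEmbedding.id.prodMap h
  exact (MeasurableEquiv.prodComm (α := Sphere2) (β := ℝ)).measurableEmbedding.comp h2

lemma measurePreserving_polar :
    MeasurePreserving (fun x : Polar => ((homeomorphUnitSphereProd _).symm x :
        ({0}ᶜ : Set (EuclideanSpace ℝ (Fin 3)))))
      (polarMeasure.withDensity fun x => ENNReal.ofReal (x.2.1 ^ 2))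
      (Measure.comap Subtype.val volume) := by
  have h := Measure.measurePreserving_homeomorphUnitSphereProd
    (volume : Measure (EuclideanSpace ℝ (Fin 3)))
  have hd : Module.finrank ℝ (EuclideanSpace ℝ (Fin 3)) - 1 = 2 := by simp
  rw [hd, Measure.volumeIoiPow, prod_withDensity_right
    (show Measurable fun r : Set.Ioi (0 : ℝ) => ENNReal.ofReal (r.1 ^ 2) by fun_prop)] at h
  exact h.symm (homeomorphUnitSphereProd _).toMeasurableEquiv

/-- The radial weight r² vanishes nowhere on (0, ∞), so the unweighted measure has no additional
mass on preimages of null sets. This carries almost everywhere measurability of g over to the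
coordinates (u, Σ). -/
lemma quasiMeasurePreserving_ofSpherical :
    Measure.QuasiMeasurePreserving ofSpherical radialMeasure volume := by
  refine ⟨continuous_ofSpherical.measurable, ?_⟩
  have hac : polarMeasure ≪ polarMeasure.withDensity fun x => ENNReal.ofReal (x.2.1 ^ 2) := by
    refine withDensity_absolutelyContinuous' (by fun_prop) (Eventually.of_forall fun x => ?_)
    have : 0 < x.2.1 := x.2.2
    simp only [ne_eq, ENNReal.ofReal_eq_zero, not_le]
    positivity
  have h1 : (polarMeasure.map fun x : Polar => ((homeomorphUnitSphereProd _).symm x :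
        ({0}ᶜ : Set (EuclideanSpace ℝ (Fin 3))))) ≪ Measure.comap Subtype.val volume :=
    (hac.map measurePreserving_polar.measurable).trans
      measurePreserving_polar.quasiMeasurePreserving.absolutelyContinuous
  have h2 := (measurePreserving_subtype_coe (μa := (volume : Measure (EuclideanSpace ℝ (Fin 3))))
    (measurableSet_singleton 0).compl)
  have h3 := (h1.map h2.measurable).trans
    (h2.quasiMeasurePreserving.absolutelyContinuous.trans Measure.restrict_le_self.absolutelyContinuous)
  rw [← measurePreserving_toMode.map_eq, Measure.map_map continuous_ofSpherical.measurable
    measurePreserving_toMode.measurable]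
  rw [Measure.map_map h2.measurable measurePreserving_polar.measurable] at h3
  exact h3

lemma integrable_sq_mul_comp_ofSpherical {f : EuclideanSpace ℝ (Fin 3) → ℝ} (hf : Integrable f) :
    Integrable (fun x : Mode => x.1 ^ 2 * f (ofSpherical x)) radialMeasure := by
  have h1 : Integrable (f ∘ Subtype.val)
      (Measure.comap (Subtype.val : ({0}ᶜ : Set (EuclideanSpace ℝ (Fin 3))) → _) volume) :=
    (integrableOn_iff_comap_subtypeVal (measurableSet_singleton 0).compl).1 hf.integrableOn
  have h2 := (measurePreserving_polar.integrable_comp_emb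
    (homeomorphUnitSphereProd _).symm.measurableEmbedding).2 h1
  rw [integrable_withDensity_iff_integrable_smul' (by fun_prop)
    (Eventually.of_forall fun x => ENNReal.ofReal_lt_top)] at h2
  rw [← measurePreserving_toMode.integrable_comp_emb measurableEmbedding_toMode]
  refine h2.congr (Eventually.of_forall fun x => ?_)
  simp only [Function.comp_apply, smul_eq_mul]
  rw [ENNReal.toReal_ofReal (sq_nonneg _)]
  rfl

/-! ### The thermal form factor and detailed balance -/

namespace Model

variable (M : Model)

/-- The spectral density of the Liouville representation. -/
def thermalDensity (u : ℝ) : ℝ := ∫ s, ‖M.thermalFormFactor (u, s)‖ ^ 2 ∂surfaceMeasure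

lemma norm_sq_thermalFormFactor {x : Mode} (hx : 0 < x.1) (hβ : 0 < M.β) :
    ‖M.thermalFormFactor x‖ ^ 2 =
      x.1 ^ 2 / (1 - Real.exp (-M.β * x.1)) * ‖M.g (ofSpherical x)‖ ^ 2 := by
  have h : 0 < 1 - Real.exp (-M.β * x.1) := by
    have : Real.exp (-M.β * x.1) < 1 := Real.exp_lt_one_iff.2 (by nlinarith [mul_pos hβ hx])
    linarith
  rw [thermalFormFactor, if_pos hx.le, norm_mul, mul_pow, Complex.norm_real, Real.norm_eq_abs,
    sq_abs, mul_pow, Real.sq_sqrt (by positivity), Real.sq_sqrt (abs_nonneg _), abs_of_pos hx]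
  simp only [ofSpherical]
  ring

/-- The symmetry of the thermal form factor that makes the modular conjugation work. -/
lemma thermalFormFactor_neg (x : Mode) :
    (starRingEnd ℂ) (M.thermalFormFactor (-x.1, x.2)) =
      -(Real.exp (-M.β * x.1 / 2) * M.thermalFormFactor x) := by
  obtain ⟨u, s⟩ := x
  have h1 : -u / (1 - Real.exp (-M.β * -u)) =
      Real.exp (-M.β * u) * (u / (1 - Real.exp (-M.β * u))) := by
    have he : Real.exp (-M.β * -u) = (Real.exp (-M.β * u))⁻¹ := by
      rw [← Real.exp_neg]; congr 1; ring
    have h0 := (Real.exp_pos (-M.β * u)).ne'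
    rw [he]
    generalize Real.exp (-M.β * u) = y at h0 ⊢
    -- The case y = 1 is βu = 0: both denominators vanish, and division by zero makes both sides 0.
    rcases eq_or_ne y 1 with rfl | hy
    · simp
    · have h2 : 1 - y ≠ 0 := sub_ne_zero.2 hy.symm
      have h3 : 1 - y⁻¹ = -(1 - y) / y := by field_simp; ring
      rw [h3]
      field_simp
  have h2 : √(-u / (1 - Real.exp (-M.β * -u))) =
      Real.exp (-M.β * u / 2) * √(u / (1 - Real.exp (-M.β * u))) := by
    rw [h1, Real.sqrt_mul (Real.exp_pos _).le, Real.exp_half]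
  simp only [thermalFormFactor, h2, abs_neg, neg_neg]
  rcases lt_trichotomy u 0 with hu | rfl | hu
  · rw [if_pos (by linarith), if_neg (by linarith)]
    simp only [map_mul, Complex.conj_ofReal]
    push_cast
    ring
  · simp
  · rw [if_neg (by linarith), if_pos hu.le]
    simp only [map_mul, Complex.conj_ofReal, map_neg, Complex.conj_conj]
    push_cast
    ring

lemma norm_sq_thermalFormFactor_neg (x : Mode) :
    ‖M.thermalFormFactor (-x.1, x.2)‖ ^ 2 =
      Real.exp (-M.β * x.1) * ‖M.thermalFormFactor x‖ ^ 2 := by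
  rw [← Complex.norm_conj, thermalFormFactor_neg, norm_neg, norm_mul, mul_pow, Complex.norm_real,
    Real.norm_eq_abs, sq_abs, ← Real.exp_nat_mul]
  congr 2
  push_cast
  ring

lemma thermalDensity_neg (u : ℝ) :
    M.thermalDensity (-u) = Real.exp (-M.β * u) * M.thermalDensity u := by
  simp only [thermalDensity]
  rw [← integral_const_mul]
  congr 1
  funext s
  exact M.norm_sq_thermalFormFactor_neg (u, s)

lemma thermalDensity_of_pos {u : ℝ} (hu : 0 < u) (hβ : 0 < M.β) :
    M.thermalDensity u = 2 / Real.pi * M.spectralDensity u / (1 - Real.exp (-M.β * u)) := by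
  simp only [thermalDensity, spectralDensity]
  simp_rw [M.norm_sq_thermalFormFactor (x := (u, _)) hu hβ]
  rw [integral_const_mul]
  simp only [ofSpherical]
  field_simp

end Model

/-! ### Integrability of the thermal density -/

/-- The reflection `(u, Σ) ↦ (-u, Σ)`. -/
def reflect (x : Mode) : Mode := (-x.1, x.2)

/-- The product measure `du × dΣ` on `(-∞, 0) × S²`. -/
def negRadialMeasure : Measure Mode := (volume.restrict (Set.Iio (0 : ℝ))).prod surfaceMeasure

lemma modeMeasure_eq : modeMeasure = radialMeasure + negRadialMeasure := by
  have h : (volume : Measure ℝ) = volume.restrict (Set.Ioi 0) + volume.restrict (Set.Iio 0) := by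
    conv_lhs => rw [← Measure.restrict_add_restrict_compl (μ := volume) (measurableSet_Ioi (a := (0 : ℝ)))]
    rw [Set.compl_Ioi, Measure.restrict_congr_set Iio_ae_eq_Iic]
  rw [modeMeasure, h, Measure.add_prod, radialMeasure, negRadialMeasure]

lemma measurePreserving_reflect : MeasurePreserving reflect negRadialMeasure radialMeasure := by
  have h := (Measure.measurePreserving_neg (volume : Measure ℝ)).restrict_preimage
    (measurableSet_Ioi (a := (0 : ℝ)))
  have h2 : (Neg.neg ⁻¹' Set.Ioi (0 : ℝ)) = Set.Iio 0 := by ext; simp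
  rw [h2] at h
  exact h.prod (MeasurePreserving.id surfaceMeasure)

lemma measurableEmbedding_reflect : MeasurableEmbedding reflect :=
  (MeasurableEquiv.prodCongr (MeasurableEquiv.neg ℝ) (MeasurableEquiv.refl _)).measurableEmbedding

lemma ae_radialMeasure : ∀ᵐ x ∂radialMeasure, 0 < x.1 :=
  Measure.quasiMeasurePreserving_fst.ae (ae_restrict_mem measurableSet_Ioi)

lemma ae_negRadialMeasure : ∀ᵐ x ∂negRadialMeasure, x.1 < 0 :=
  Measure.quasiMeasurePreserving_fst.ae (ae_restrict_mem measurableSet_Iio)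

/-- The thermal factor is at most of order 1/x at the origin, a singularity that J(u) = O(u)
compensates. -/
lemma inv_one_sub_exp_neg_le {x : ℝ} (hx : 0 < x) : (1 - Real.exp (-x))⁻¹ ≤ 1 + x⁻¹ := by
  have h1 : Real.exp (-x) ≤ (1 + x)⁻¹ := by
    rw [Real.exp_neg]
    gcongr
    linarith [Real.add_one_le_exp x]
  have h2 : 1 + x⁻¹ = (1 - (1 + x)⁻¹)⁻¹ := by
    have : 1 - (1 + x)⁻¹ = x / (1 + x) := by field_simp; ring
    rw [this]
    field_simp
    ring
  rw [h2]
  have : (1 + x)⁻¹ < 1 := inv_lt_one_of_one_lt₀ (by linarith)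
  gcongr

namespace Model

variable {M : Model}

lemma aestronglyMeasurable_thermalFormFactor
    (hg : AEStronglyMeasurable M.g (volume : Measure (EuclideanSpace ℝ (Fin 3)))) :
    AEStronglyMeasurable M.thermalFormFactor modeMeasure := by
  have h1 := hg.comp_quasiMeasurePreserving quasiMeasurePreserving_ofSpherical
  have h2 := h1.comp_quasiMeasurePreserving measurePreserving_reflect.quasiMeasurePreserving
  have hc : Measurable fun x : Mode =>
      ((√(x.1 / (1 - Real.exp (-M.β * x.1))) * √|x.1| : ℝ) : ℂ) := by fun_prop
  rw [modeMeasure_eq, aestronglyMeasurable_add_measure_iff]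
  constructor
  · refine (hc.aestronglyMeasurable.mul h1).congr ?_
    filter_upwards [ae_radialMeasure] with x hx
    simp [thermalFormFactor, hx.le, ofSpherical]
  · refine (hc.aestronglyMeasurable.mul
      (Complex.continuous_conj.comp_aestronglyMeasurable h2).neg).congr ?_
    filter_upwards [ae_negRadialMeasure] with x hx
    simp [thermalFormFactor, not_le.2 hx, ofSpherical, reflect]

lemma spectralDensity_nonneg (ω : ℝ) : 0 ≤ M.spectralDensity ω := by
  unfold spectralDensity
  have : 0 ≤ ∫ s : Sphere2, ‖M.g (ω • (s : EuclideanSpace ℝ (Fin 3)))‖ ^ 2 ∂surfaceMeasure :=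
    integral_nonneg fun _ => by positivity
  positivity

lemma integrable_sq_mul_norm_sq (hg : MemLp M.g 2 (volume : Measure (EuclideanSpace ℝ (Fin 3)))) :
    Integrable (fun x : Mode => x.1 ^ 2 * ‖M.g (ofSpherical x)‖ ^ 2) radialMeasure :=
  integrable_sq_mul_comp_ofSpherical ((memLp_two_iff_integrable_sq_norm hg.1).1 hg)

lemma integrableOn_spectralDensity
    (hg : MemLp M.g 2 (volume : Measure (EuclideanSpace ℝ (Fin 3)))) :
    IntegrableOn M.spectralDensity (Set.Ioi 0) := by
  have h := ((integrable_sq_mul_norm_sq hg).integral_prod_left).const_mul (Real.pi / 2)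
  refine h.congr (Eventually.of_forall fun u => ?_)
  simp only [spectralDensity, integral_const_mul, ofSpherical]
  ring

lemma integrableOn_thermalDensity (hβ : 0 < M.β)
    (hg : MemLp M.g 2 (volume : Measure (EuclideanSpace ℝ (Fin 3)))) {J₀ : ℝ}
    (hJ₀ : Tendsto (fun ω : ℝ => M.spectralDensity ω / ω) (𝓝[>] 0) (𝓝 J₀)) :
    IntegrableOn M.thermalDensity (Set.Ioi 0) := by
  have hJ := integrableOn_spectralDensity hg
  -- Below δ the quotient J(u)/u is bounded by the existence of the limit; above δ the factor 1/(βu)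
  -- is bounded by 1/(βδ) and J itself is integrable.
  obtain ⟨δ, hδ, hb⟩ : ∃ δ > 0, ∀ u ∈ Set.Ioo 0 δ, M.spectralDensity u / u < J₀ + 1 := by
    have := hJ₀.eventually (gt_mem_nhds (lt_add_one J₀))
    obtain ⟨δ, hδ, h⟩ := mem_nhdsGT_iff_exists_Ioo_subset.1 this
    exact ⟨δ, hδ, h⟩
  have hpos : ∀ u : ℝ, 0 < u → 0 < 1 - Real.exp (-M.β * u) := fun u hu => by
    have : Real.exp (-M.β * u) < 1 := Real.exp_lt_one_iff.2 (by nlinarith [mul_pos hβ hu])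
    linarith
  have hmain : IntegrableOn (fun u => M.spectralDensity u / (1 - Real.exp (-M.β * u)))
      (Set.Ioi 0) := by
    have hdom : IntegrableOn (fun u => (1 + (M.β * δ)⁻¹) * M.spectralDensity u +
        Set.indicator (Set.Ioo 0 δ) (fun _ => |J₀ + 1| * M.β⁻¹) u) (Set.Ioi 0) := by
      refine (hJ.const_mul _).add ?_
      refine Integrable.integrableOn ((integrable_indicator_iff measurableSet_Ioo).2 ?_)
      exact integrableOn_const (by simp)
    refine hdom.mono' ?_ ?_
    · exact (hJ.aestronglyMeasurable.aemeasurable.div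
        (Measurable.aemeasurable (by fun_prop))).aestronglyMeasurable
    · filter_upwards [ae_restrict_mem measurableSet_Ioi] with u (hu : 0 < u)
      have hJn := M.spectralDensity_nonneg u
      have h1 := inv_one_sub_exp_neg_le (mul_pos hβ hu)
      rw [← neg_mul] at h1
      rw [Real.norm_of_nonneg (div_nonneg hJn (hpos u hu).le), div_eq_mul_inv]
      have h2 : M.spectralDensity u * (1 - Real.exp (-M.β * u))⁻¹ ≤
          M.spectralDensity u + M.spectralDensity u / u * M.β⁻¹ :=
        (mul_le_mul_of_nonneg_left h1 hJn).trans (le_of_eq (by field_simp))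
      refine h2.trans ?_
      by_cases hd : u ∈ Set.Ioo 0 δ
      · rw [Set.indicator_of_mem hd]
        have h3 : M.spectralDensity u / u * M.β⁻¹ ≤ |J₀ + 1| * M.β⁻¹ := by
          gcongr
          exact (hb u hd).le.trans (le_abs_self _)
        have : 0 ≤ (M.β * δ)⁻¹ * M.spectralDensity u := by positivity
        linarith
      · rw [Set.indicator_of_notMem hd]
        have hd' : δ ≤ u := not_lt.1 fun h => hd ⟨hu, h⟩
        have h3 : M.spectralDensity u / u * M.β⁻¹ ≤ M.spectralDensity u / δ * M.β⁻¹ := by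
          gcongr
        have h4 : M.spectralDensity u / δ * M.β⁻¹ = (M.β * δ)⁻¹ * M.spectralDensity u := by
          field_simp
        linarith
  refine (hmain.const_mul (2 / Real.pi)).congr ?_
  filter_upwards [ae_restrict_mem measurableSet_Ioi] with u (hu : 0 < u)
  rw [thermalDensity_of_pos M hu hβ]
  ring

/-- On u > 0 this is Tonelli, from the angular integrals and the radial bound. The half u < 0 is its
mirror image with the additional weight exp(-βu) ≤ 1. -/
lemma integrable_norm_sq_thermalFormFactor (hβ : 0 < M.β)
    (hg : MemLp M.g 2 (volume : Measure (EuclideanSpace ℝ (Fin 3)))) {J₀ : ℝ}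
    (hJ₀ : Tendsto (fun ω : ℝ => M.spectralDensity ω / ω) (𝓝[>] 0) (𝓝 J₀)) :
    Integrable (fun x => ‖M.thermalFormFactor x‖ ^ 2) modeMeasure := by
  have hmeas := aestronglyMeasurable_thermalFormFactor hg.1
  have hpos : Integrable (fun x => ‖M.thermalFormFactor x‖ ^ 2) radialMeasure := by
    have hm : AEStronglyMeasurable (fun x => ‖M.thermalFormFactor x‖ ^ 2) radialMeasure := by
      rw [modeMeasure_eq, aestronglyMeasurable_add_measure_iff] at hmeas
      exact hmeas.1.norm.pow 2
    refine (integrable_prod_iff hm).2 ⟨?_, ?_⟩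
    · filter_upwards [(integrable_sq_mul_norm_sq hg).prod_right_ae,
        ae_restrict_mem measurableSet_Ioi] with u hu (hu0 : 0 < u)
      refine (hu.const_mul (1 - Real.exp (-M.β * u))⁻¹).congr (Eventually.of_forall fun s => ?_)
      simp only
      rw [M.norm_sq_thermalFormFactor (x := (u, s)) hu0 hβ]
      ring
    · refine (integrableOn_thermalDensity hβ hg hJ₀).congr (Eventually.of_forall fun u => ?_)
      simp [thermalDensity]
  rw [modeMeasure_eq, integrable_add_measure]
  refine ⟨hpos, ?_⟩
  rw [← integrable_congr (f := (fun x => Real.exp (-M.β * x.1) * ‖M.thermalFormFactor x‖ ^ 2) ∘ reflect)]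
  · refine (measurePreserving_reflect.integrable_comp_emb measurableEmbedding_reflect).2 ?_
    refine hpos.bdd_mul (c := 1) (Measurable.aestronglyMeasurable (by fun_prop)) ?_
    filter_upwards [ae_radialMeasure] with x hx
    rw [Real.norm_of_nonneg (Real.exp_pos _).le, Real.exp_le_one_iff]
    nlinarith [mul_pos hβ hx]
  · refine Eventually.of_forall fun x => ?_
    have := M.norm_sq_thermalFormFactor_neg (reflect x)
    simp only [reflect, neg_neg, Function.comp_apply] at this ⊢
    exact this.symm

lemma integrable_thermalDensity (hβ : 0 < M.β)
    (hg : MemLp M.g 2 (volume : Measure (EuclideanSpace ℝ (Fin 3)))) {J₀ : ℝ}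
    (hJ₀ : Tendsto (fun ω : ℝ => M.spectralDensity ω / ω) (𝓝[>] 0) (𝓝 J₀)) :
    Integrable M.thermalDensity :=
  (integrable_norm_sq_thermalFormFactor hβ hg hJ₀).integral_prod_left

/-- Integration over the angles in a resolvent matrix element. -/
lemma integral_norm_sq_mul_inv (hβ : 0 < M.β)
    (hg : MemLp M.g 2 (volume : Measure (EuclideanSpace ℝ (Fin 3)))) {J₀ : ℝ}
    (hJ₀ : Tendsto (fun ω : ℝ => M.spectralDensity ω / ω) (𝓝[>] 0) (𝓝 J₀)) (a : ℝ) {ε : ℝ}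
    (hε : 0 < ε) :
    ∫ x, ((‖M.thermalFormFactor x‖ ^ 2 : ℝ) : ℂ) * (((x.1 - a : ℝ) : ℂ) + Complex.I * ε)⁻¹
      ∂modeMeasure = cauchyTransform M.thermalDensity a ε := by
  have hi : Integrable (fun x : Mode => ((‖M.thermalFormFactor x‖ ^ 2 : ℝ) : ℂ) *
      (((x.1 - a : ℝ) : ℂ) + Complex.I * ε)⁻¹) modeMeasure :=
    (integrable_norm_sq_thermalFormFactor hβ hg hJ₀).ofReal.mul_bdd
      ((continuous_inv_add_I_mul a hε).comp continuous_fst).aestronglyMeasurable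
      (Eventually.of_forall fun x => norm_inv_add_I_mul_le_inv _ hε)
  rw [modeMeasure, integral_prod _ hi, cauchyTransform]
  congr 1
  funext u
  simp only
  rw [integral_mul_const, thermalDensity, integral_complex_ofReal]

lemma differentiableAt_thermalDensity_gap (hgap : 0 < M.gap) (hβ : 0 < M.β)
    (hreg : DifferentiableAt ℝ M.spectralDensity M.gap) :
    DifferentiableAt ℝ M.thermalDensity M.gap := by
  have h : M.thermalDensity =ᶠ[𝓝 M.gap] fun u =>
      2 / Real.pi * M.spectralDensity u / (1 - Real.exp (-M.β * u)) := by
    filter_upwards [lt_mem_nhds hgap] with u hu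
    exact thermalDensity_of_pos M hu hβ
  refine DifferentiableAt.congr_of_eventuallyEq ?_ h
  have : Real.exp (-M.β * M.gap) < 1 := Real.exp_lt_one_iff.2 (by nlinarith [mul_pos hβ hgap])
  exact (hreg.const_mul _).div (by fun_prop) (by linarith)

/-- Detailed balance transports the regularity at Δ to -Δ. -/
lemma differentiableAt_thermalDensity_neg_gap (hgap : 0 < M.gap) (hβ : 0 < M.β)
    (hreg : DifferentiableAt ℝ M.spectralDensity M.gap) :
    DifferentiableAt ℝ M.thermalDensity (-M.gap) := by
  have h : M.thermalDensity = fun v => Real.exp (M.β * v) * M.thermalDensity (-v) := by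
    funext v
    have := M.thermalDensity_neg (-v)
    simpa using this
  rw [h]
  refine DifferentiableAt.mul (by fun_prop) ?_
  refine DifferentiableAt.comp (g := M.thermalDensity) (f := fun v => -v) (-M.gap) ?_ (by fun_prop)
  rw [neg_neg]
  exact differentiableAt_thermalDensity_gap hgap hβ hreg

/-! ### Boundary values at the Bohr frequencies -/

/-- The decay rate `J(Δ) / (1 - exp(-βΔ))` of the upper level, in units of `2 λ²`. -/
def rate (M : Model) : ℝ := M.spectralDensity M.gap / (1 - Real.exp (-M.β * M.gap))

lemma rate_pos (hgap : 0 < M.gap) (hβ : 0 < M.β) (hJ : 0 < M.spectralDensity M.gap) :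
    0 < M.rate := by
  have : Real.exp (-M.β * M.gap) < 1 := Real.exp_lt_one_iff.2 (by nlinarith [mul_pos hβ hgap])
  exact div_pos hJ (by linarith)

/-- Existence of the boundary values of the reservoir correlation functions at the Bohr
frequencies `±Δ`, with the detailed balance relation between their imaginary parts. -/
theorem exists_tendsto_cauchyTransform_thermalDensity (hgap : 0 < M.gap) (hβ : 0 < M.β)
    (hg : MemLp M.g 2 (volume : Measure (EuclideanSpace ℝ (Fin 3))))
    (hreg : DifferentiableAt ℝ M.spectralDensity M.gap) {J₀ : ℝ}
    (hJ₀ : Tendsto (fun ω : ℝ => M.spectralDensity ω / ω) (𝓝[>] 0) (𝓝 J₀)) :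
    ∃ x y : ℝ,
      Tendsto (cauchyTransform M.thermalDensity M.gap) (𝓝[>] 0)
        (𝓝 (2 * ((x : ℂ) - Complex.I * M.rate))) ∧
      Tendsto (cauchyTransform M.thermalDensity (-M.gap)) (𝓝[>] 0)
        (𝓝 (2 * ((y : ℂ) - Complex.I * (Real.exp (-M.β * M.gap) * M.rate : ℝ)))) := by
  have hi := integrable_thermalDensity hβ hg hJ₀
  obtain ⟨x, hx⟩ := exists_tendsto_cauchyTransform hi
    (differentiableAt_thermalDensity_gap hgap hβ hreg)
  obtain ⟨y, hy⟩ := exists_tendsto_cauchyTransform hi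
    (differentiableAt_thermalDensity_neg_gap hgap hβ hreg)
  have h1 : Real.pi * M.thermalDensity M.gap = 2 * M.rate := by
    rw [thermalDensity_of_pos M hgap hβ, rate]
    field_simp
  have h2 : Real.pi * M.thermalDensity (-M.gap) = 2 * (Real.exp (-M.β * M.gap) * M.rate) := by
    rw [thermalDensity_neg, mul_left_comm, h1]
    ring
  refine ⟨x / 2, y / 2, ?_, ?_⟩
  · rw [h1] at hx
    convert hx using 2
    push_cast
    ring
  · rw [h2] at hy
    convert hy using 2
    push_cast
    ring

end Model

/-! ### The Liouville operator on vacuum and one-particle vectors -/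

/-- The vector `v ⊗ Ω`. -/
def vacuumState (v : Fin 3 × Fin 3 → ℂ) : WaveFunction := fun n _ p => if n = 0 then v p else 0

/-- The operator `G ⊗ 𝟙 - 𝟙 ⊗ G`. -/
def couplingCommutator (v : Fin 3 × Fin 3 → ℂ) (p : Fin 3 × Fin 3) : ℂ :=
  ∑ a, couplingMatrix p.1 a * v (a, p.2) - ∑ a, couplingMatrix p.2 a * v (p.1, a)

lemma field_vacuumState_zero (f : Mode → ℂ) (v : Fin 3 × Fin 3 → ℂ) (x : Fin 0 → Mode)
    (p : Fin 3 × Fin 3) : field f (vacuumState v) 0 x p = 0 := by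
  simp [field, creation, annihilation, vacuumState]

lemma field_vacuumState_one (f : Mode → ℂ) (v : Fin 3 × Fin 3 → ℂ) (x : Fin 1 → Mode)
    (p : Fin 3 × Fin 3) :
    field f (vacuumState v) 1 x p = ((1 / √2 : ℝ) : ℂ) * f (x 0) * v p := by
  simp [field, creation, annihilation, vacuumState, mul_assoc]

lemma modularConj_thermalWeight_vacuumState (β : ℝ) (v : Fin 3 × Fin 3 → ℂ) :
    modularConj (thermalWeight β (vacuumState v)) = vacuumState fun p => (starRingEnd ℂ) (v p) := by
  funext n x p
  rcases Nat.eq_zero_or_pos n with rfl | hn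
  · simp [modularConj, thermalWeight, vacuumState, totalEnergy]
  · simp [modularConj, thermalWeight, vacuumState, hn.ne']

namespace Model

variable {M : Model}

lemma conjField_vacuumState_zero (v : Fin 3 × Fin 3 → ℂ) (x : Fin 0 → Mode)
    (p : Fin 3 × Fin 3) : M.conjField (vacuumState v) 0 x p = 0 := by
  rw [conjField, modularConj_thermalWeight_vacuumState]
  simp [modularConj, thermalWeight, field_vacuumState_zero]

/-- The sign of `modularConj` on one particle cancels the sign in `thermalFormFactor_neg`, and the
exponentials cancel too. Both halves of the interaction thus create the same one-particle function,
and only the commutator with G remains. -/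
lemma conjField_vacuumState_one (v : Fin 3 × Fin 3 → ℂ) (x : Fin 1 → Mode)
    (p : Fin 3 × Fin 3) :
    M.conjField (vacuumState v) 1 x p =
      ((1 / √2 : ℝ) : ℂ) * M.thermalFormFactor (x 0) * v p := by
  rw [conjField, modularConj_thermalWeight_vacuumState]
  simp only [modularConj, thermalWeight, field_vacuumState_one, totalEnergy, map_mul,
    Complex.conj_ofReal, Complex.conj_conj, M.thermalFormFactor_neg (x 0)]
  simp only [Finset.univ_unique, Fin.default_eq_zero, Fin.isValue, Finset.sum_singleton, pow_one]
  have : (Real.exp (-M.β * -(x 0).1 / 2) : ℂ) * Real.exp (-M.β * (x 0).1 / 2) = 1 := by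
    rw [← Complex.ofReal_mul, ← Real.exp_add, ← Complex.ofReal_one, ← Real.exp_zero]
    congr 2
    ring
  linear_combination (((1 / √2 : ℝ) : ℂ) * M.thermalFormFactor (x 0) * v p) * this

lemma liouville_vacuumState_zero (σ lam : ℝ) (v : Fin 3 × Fin 3 → ℂ) (x : Fin 0 → Mode)
    (p : Fin 3 × Fin 3) :
    M.liouville σ lam (vacuumState v) 0 x p =
      ((M.levels σ p.1 - M.levels σ p.2 : ℝ) : ℂ) * v p := by
  simp only [liouville, interaction, leftAct, rightAct, reservoirL, Pi.add_apply, Pi.sub_apply,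
    Pi.smul_apply, field_vacuumState_zero, conjField_vacuumState_zero, totalEnergy]
  simp [systemH, vacuumState, Matrix.diagonal_apply, sub_mul]

lemma liouville_vacuumState_one (σ lam : ℝ) (v : Fin 3 × Fin 3 → ℂ) (x : Fin 1 → Mode)
    (p : Fin 3 × Fin 3) :
    M.liouville σ lam (vacuumState v) 1 x p =
      (lam * ((1 / √2 : ℝ) : ℂ) * couplingCommutator v p) * M.thermalFormFactor (x 0) := by
  simp only [liouville, interaction, leftAct, rightAct, reservoirL, Pi.add_apply, Pi.sub_apply,
    Pi.smul_apply, field_vacuumState_one, conjField_vacuumState_one, couplingCommutator]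
  simp only [vacuumState, one_ne_zero, if_false, mul_zero, Finset.sum_const_zero, sub_zero,
    zero_add, smul_eq_mul, mul_sub, sub_mul, Finset.mul_sum, Finset.sum_mul]
  congr 1 <;> exact Finset.sum_congr rfl fun a _ => by ring

/-- The annihilation part of the interaction, on a vector with no vacuum component. -/
lemma liouville_apply_zero (σ lam : ℝ) (Ψ : WaveFunction) (h0 : ∀ x p, Ψ 0 x p = 0)
    (x : Fin 0 → Mode) (p : Fin 3 × Fin 3) :
    M.liouville σ lam Ψ 0 x p = lam * (((1 / √2 : ℝ) : ℂ) *
      (∑ a, couplingMatrix p.1 a *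
        ∫ y, (starRingEnd ℂ) (M.thermalFormFactor y) * Ψ 1 (fun _ => y) (a, p.2) ∂modeMeasure +
      ∑ a, couplingMatrix p.2 a *
        ∫ y, M.thermalFormFactor y * (Real.exp (M.β * y.1 / 2) *
          Ψ 1 (fun _ => reflect y) (p.1, a)) ∂modeMeasure)) := by
  have hc : ∀ y : Mode, (Fin.cons y x : Fin 1 → Mode) = fun _ => y := fun y => by
    funext j; rw [Subsingleton.elim (α := Fin 1) j 0]; rfl
  have h1 : ∀ p, field M.thermalFormFactor Ψ 0 x p = ((1 / √2 : ℝ) : ℂ) *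
      ∫ y, (starRingEnd ℂ) (M.thermalFormFactor y) * Ψ 1 (fun _ => y) p ∂modeMeasure := by
    intro p
    simp [field, creation, annihilation, hc]
  -- The minus sign is that of `modularConj` on one particle. It turns the difference in the
  -- interaction into a sum.
  have h2 : ∀ p, M.conjField Ψ 0 x p = -(((1 / √2 : ℝ) : ℂ) *
      ∫ y, M.thermalFormFactor y * (Real.exp (M.β * y.1 / 2) *
        Ψ 1 (fun _ => reflect y) p) ∂modeMeasure) := by
    intro p
    have hx : (fun j : Fin 0 => (-(x j).1, (x j).2)) = x := Subsingleton.elim _ _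
    simp only [conjField, modularConj, thermalWeight, field, creation, annihilation, hx, hc,
      totalEnergy, map_mul, Complex.conj_ofReal, zero_add, ← integral_conj,
      Complex.conj_conj, map_neg, map_one, pow_zero, one_mul, pow_one]
    simp only [Finset.univ_eq_empty, Finset.sum_empty, Finset.sum_const, mul_zero, zero_div,
      Real.exp_zero, Complex.ofReal_one, one_mul, CharP.cast_eq_zero, zero_add, Real.sqrt_one,
      neg_mul, mul_neg, integral_neg]
    refine congrArg _ (congrArg _ (integral_congr_ae (Eventually.of_forall fun y => ?_)))
    simp [reflect]
  simp only [liouville, interaction, leftAct, rightAct, reservoirL, Pi.add_apply, Pi.sub_apply,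
    Pi.smul_apply, h0, h1, h2, mul_zero, Finset.sum_const_zero, sub_zero, zero_add, smul_eq_mul]
  rw [mul_add, Finset.mul_sum, Finset.mul_sum, sub_eq_add_neg, ← Finset.sum_neg_distrib]
  congr 2 <;> exact Finset.sum_congr rfl fun a _ => by ring


/-! ### Existence and form of the level shift operators -/

/-- The second order part of the level shift operators, given the boundary values `F a` of the
Cauchy transform of the reservoir spectral density. -/
def secondOrder (M : Model) (F : ℝ → ℂ) (e : ℝ) (v : Fin 3 × Fin 3 → ℂ) (p : Fin 3 × Fin 3) : ℂ :=
  2⁻¹ * (∑ a, couplingMatrix p.1 a * (couplingCommutator v (a, p.2) * F (e - M.bohr (a, p.2))) +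
    ∑ a, couplingMatrix p.2 a * (couplingCommutator v (p.1, a) *
      (starRingEnd ℂ) (F (M.bohr (p.1, a) - e))))

lemma ofReal_one_div_sqrt_two_mul_self : ((1 / √2 : ℝ) : ℂ) * ((1 / √2 : ℝ) : ℂ) = 2⁻¹ := by
  rw [← Complex.ofReal_mul, div_mul_div_comm, Real.mul_self_sqrt (by norm_num)]
  norm_num

/-- The second order term creates one particle, propagates it by the free resolvent and annihilates
it. Annihilation by the left field gives a Cauchy transform, annihilation by the conjugate field a
complex conjugate one at the opposite frequency. -/
lemma levelShiftReg_eq (hβ : 0 < M.β)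
    (hg : MemLp M.g 2 (volume : Measure (EuclideanSpace ℝ (Fin 3)))) {J₀ : ℝ}
    (hJ₀ : Tendsto (fun ω : ℝ => M.spectralDensity ω / ω) (𝓝[>] 0) (𝓝 J₀)) (σ lam e : ℝ) {ε : ℝ}
    (hε : 0 < ε) (p q : Fin 3 × Fin 3) :
    M.levelShiftReg σ lam e ε p q =
      if M.bohr p = e ∧ M.bohr q = e then
        ((M.levels σ p.1 - M.levels σ p.2 : ℝ) : ℂ) * (Pi.single q 1 : Fin 3 × Fin 3 → ℂ) p -
          lam ^ 2 * M.secondOrder (fun a => cauchyTransform M.thermalDensity a ε) e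
            (Pi.single q 1) p
      else 0 := by
  set v : Fin 3 × Fin 3 → ℂ := if M.bohr q = e then Pi.single q 1 else 0 with hv
  have hstate : M.proj e (vacuumVector q) = vacuumState v := by
    funext n x p
    simp only [proj, vacuumVector, vacuumState, hv]
    by_cases hn : n = 0 <;> by_cases hp : p = q <;> by_cases hq : M.bohr q = e <;>
      simp_all
  have hsupp : ∀ p, M.bohr p ≠ e → v p = 0 := by
    intro p hp
    by_cases hq : M.bohr q = e
    · rw [hv, if_pos hq, Pi.single_eq_of_ne]
      rintro rfl
      exact hp hq
    · simp [hv, hq]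
  set Φ := M.liouville σ lam (vacuumState v) with hΦ
  set Ψ := M.coproj e (M.resolvent e ε (M.coproj e Φ)) with hΨ
  -- H_S(σ) is diagonal, so the vacuum part of Φ stays in the range of P_e and the complementary
  -- projection removes it.
  have hΨ0 : ∀ x p, Ψ 0 x p = 0 := by
    intro x p
    simp only [hΨ, coproj, resolvent, proj, Pi.sub_apply]
    by_cases hp : M.bohr p = e
    · simp [hp]
    · simp [hp, hΦ, liouville_vacuumState_zero, hsupp p hp]
  have hΨ1 : ∀ y p, Ψ 1 (fun _ => y) p =
      (((y.1 - (e - M.bohr p) : ℝ) : ℂ) + Complex.I * ε)⁻¹ *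
        ((lam * ((1 / √2 : ℝ) : ℂ) * couplingCommutator v p) * M.thermalFormFactor y) := by
    intro y p
    simp only [hΨ, coproj, resolvent, proj, Pi.sub_apply, one_ne_zero, false_and, if_false,
      sub_zero, hΦ, liouville_vacuumState_one, totalEnergy, Finset.univ_unique,
      Finset.sum_singleton]
    congr 3
    norm_cast
    ring
  have hnorm : ∀ z : ℂ, (starRingEnd ℂ) z * z = ((‖z‖ ^ 2 : ℝ) : ℂ) := fun z => by
    rw [Complex.conj_mul', Complex.ofReal_pow]
  have hleft : ∀ p, ∫ y, (starRingEnd ℂ) (M.thermalFormFactor y) * Ψ 1 (fun _ => y) p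
      ∂modeMeasure = (lam * ((1 / √2 : ℝ) : ℂ) * couplingCommutator v p) *
        cauchyTransform M.thermalDensity (e - M.bohr p) ε := by
    intro p
    rw [← integral_norm_sq_mul_inv hβ hg hJ₀ _ hε, ← integral_const_mul]
    refine integral_congr_ae (Eventually.of_forall fun y => ?_)
    simp only [hΨ1, ← hnorm]
    ring
  have hright : ∀ p, ∫ y, M.thermalFormFactor y * (Real.exp (M.β * y.1 / 2) *
      Ψ 1 (fun _ => reflect y) p) ∂modeMeasure =
      (lam * ((1 / √2 : ℝ) : ℂ) * couplingCommutator v p) *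
        (starRingEnd ℂ) (cauchyTransform M.thermalDensity (M.bohr p - e) ε) := by
    intro p
    rw [← integral_norm_sq_mul_inv hβ hg hJ₀ _ hε, ← integral_conj, ← integral_const_mul]
    refine integral_congr_ae (Eventually.of_forall fun y => ?_)
    -- Reflection produces one sign in the form factor and one in the energy denominator. They
    -- cancel, and the denominator is conjugated.
    have h1 : (Real.exp (M.β * y.1 / 2) : ℂ) * M.thermalFormFactor (reflect y) =
        -(starRingEnd ℂ) (M.thermalFormFactor y) := by
      have h2 := M.thermalFormFactor_neg (reflect y)
      simp only [reflect, neg_neg, mul_neg, neg_mul] at h2 ⊢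
      rw [Prod.mk.eta] at h2
      rw [h2, neg_neg]
    have h3 : (((reflect y).1 - (e - M.bohr p) : ℝ) : ℂ) + Complex.I * ε =
        -(starRingEnd ℂ) (((y.1 - (M.bohr p - e) : ℝ) : ℂ) + Complex.I * ε) := by
      simp only [reflect, map_add, map_mul, Complex.conj_ofReal, Complex.conj_I]
      push_cast
      ring
    simp only [hΨ1, h3, map_mul, map_inv₀, Complex.conj_conj, ← hnorm, inv_neg]
    linear_combination (-(M.thermalFormFactor y *
      ((starRingEnd ℂ) (((y.1 - (M.bohr p - e) : ℝ) : ℂ) + Complex.I * ε))⁻¹ *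
      (lam * ((1 / √2 : ℝ) : ℂ) * couplingCommutator v p))) * h1
  have hmain : M.levelShiftReg σ lam e ε p q = if M.bohr p = e then
      ((M.levels σ p.1 - M.levels σ p.2 : ℝ) : ℂ) * v p -
          lam ^ 2 * M.secondOrder (fun a => cauchyTransform M.thermalDensity a ε) e v p
      else 0 := by
    simp only [levelShiftReg, hstate]
    simp only [← hΦ, ← hΨ, proj, true_and, Pi.sub_apply]
    refine if_congr Iff.rfl ?_ rfl
    rw [hΦ, liouville_vacuumState_zero, liouville_apply_zero _ _ _ hΨ0]
    simp only [hleft, hright, secondOrder]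
    rw [← ofReal_one_div_sqrt_two_mul_self]
    simp only [mul_add, Finset.mul_sum]
    congr 2 <;> exact Finset.sum_congr rfl fun a _ => by ring
  rw [hmain]
  by_cases hq : M.bohr q = e
  · simp only [hv, hq, if_true, and_true]
  · have : v = 0 := by simp [hv, hq]
    simp [hq, this, secondOrder, couplingCommutator]


/-- This is why boundary values are needed only at ±Δ: the coupling induces no transition at
frequency zero. -/
lemma levels_sub_of_coupling_ne_zero {i j : Fin 3} (h : couplingMatrix i j ≠ 0) :
    M.levels 0 i - M.levels 0 j = M.gap ∨ M.levels 0 i - M.levels 0 j = -M.gap := by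
  fin_cases i <;> fin_cases j <;> simp_all [couplingMatrix, levels, gap]

/-- The matrix elements of the level shift operators, given boundary values `F (±Δ)` of the
Cauchy transform of the reservoir spectral density. -/
def shiftEntry (M : Model) (F : ℝ → ℂ) (σ lam e : ℝ) : Matrix (Fin 3 × Fin 3) (Fin 3 × Fin 3) ℂ :=
  fun p q => open Classical in if M.bohr p = e ∧ M.bohr q = e then
    ((M.levels σ p.1 - M.levels σ p.2 : ℝ) : ℂ) * (Pi.single q 1 : Fin 3 × Fin 3 → ℂ) p -
      lam ^ 2 * M.secondOrder F e (Pi.single q 1) p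
  else 0

lemma tendsto_levelShiftReg (hβ : 0 < M.β)
    (hg : MemLp M.g 2 (volume : Measure (EuclideanSpace ℝ (Fin 3)))) {J₀ : ℝ}
    (hJ₀ : Tendsto (fun ω : ℝ => M.spectralDensity ω / ω) (𝓝[>] 0) (𝓝 J₀)) {F : ℝ → ℂ}
    (hF₁ : Tendsto (cauchyTransform M.thermalDensity M.gap) (𝓝[>] 0) (𝓝 (F M.gap)))
    (hF₂ : Tendsto (cauchyTransform M.thermalDensity (-M.gap)) (𝓝[>] 0) (𝓝 (F (-M.gap))))
    (σ lam e : ℝ) :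
    Tendsto (fun ε : ℝ => M.levelShiftReg σ lam e ε) (𝓝[>] 0) (𝓝 (M.shiftEntry F σ lam e)) := by
  refine tendsto_pi_nhds.2 fun p => tendsto_pi_nhds.2 fun q => ?_
  have hF : ∀ a, a = M.gap ∨ a = -M.gap →
      Tendsto (fun ε => cauchyTransform M.thermalDensity a ε) (𝓝[>] 0) (𝓝 (F a)) := by
    rintro a (rfl | rfl)
    exacts [hF₁, hF₂]
  have h : ∀ᶠ ε : ℝ in 𝓝[>] 0, M.shiftEntry (fun a => cauchyTransform M.thermalDensity a ε)
      σ lam e p q = M.levelShiftReg σ lam e ε p q := by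
    filter_upwards [self_mem_nhdsWithin] with ε hε
    exact (levelShiftReg_eq hβ hg hJ₀ σ lam e hε p q).symm
  refine Tendsto.congr' h ?_
  simp only [shiftEntry]
  split_ifs with hpq
  · have hp := hpq.1
    simp only [bohr] at hp
    refine tendsto_const_nhds.sub (Tendsto.const_mul _ (Tendsto.const_mul _ (Tendsto.add ?_ ?_)))
    · refine tendsto_finsetSum _ fun a _ => ?_
      by_cases hG : couplingMatrix p.1 a = 0
      · simp [hG]
      · refine Tendsto.const_mul _ (Tendsto.const_mul _ (hF _ ?_))
        have := levels_sub_of_coupling_ne_zero (M := M) hG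
        have h1 : e - M.bohr (a, p.2) = M.levels 0 p.1 - M.levels 0 a := by
          simp only [bohr]; linarith
        rwa [h1]
    · refine tendsto_finsetSum _ fun a _ => ?_
      by_cases hG : couplingMatrix p.2 a = 0
      · simp [hG]
      · refine Tendsto.const_mul _ (Tendsto.const_mul _
          ((Complex.continuous_conj.tendsto _).comp (hF _ ?_)))
        have := levels_sub_of_coupling_ne_zero (M := M) hG
        have h1 : M.bohr (p.1, a) - e = M.levels 0 p.2 - M.levels 0 a := by
          simp only [bohr]; linarith
        rwa [h1]
  · exact tendsto_const_nhds

/-! ### The generator in coordinates -/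

/-- The generator of the Heisenberg evolution, in coordinates: `γ` is the decay rate, `q` the
detailed balance factor, and `x`, `y` are the energy shifts. -/
def IsGenerator (M : Model) (γ q x y : ℝ) : Prop :=
  ∀ σ lam : ℝ, ∀ u : Fin 3 × Fin 3 → ℂ,
    let D : Fin 3 × Fin 3 → ℂ := fun p => Complex.I * (M.totalLevelShift σ lam).mulVec u p
    let s : ℂ := Complex.I * y
    D (0, 0) = lam ^ 2 * (-4 * γ * u (0, 0) +
      2 * γ * (u (1, 1) + u (1, 2) + u (2, 1) + u (2, 2))) ∧
    D (1, 1) = lam ^ 2 * (2 * q * γ * u (0, 0) - 2 * q * γ * u (1, 1) +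
      (s - q * γ) * u (1, 2) + (-s - q * γ) * u (2, 1)) ∧
    D (1, 2) = Complex.I * σ * u (1, 2) + lam ^ 2 * (2 * q * γ * u (0, 0) -
      2 * q * γ * u (1, 2) + (s - q * γ) * u (1, 1) + (-s - q * γ) * u (2, 2)) ∧
    D (2, 1) = -(Complex.I * σ * u (2, 1)) + lam ^ 2 * (2 * q * γ * u (0, 0) -
      2 * q * γ * u (2, 1) + (s - q * γ) * u (2, 2) + (-s - q * γ) * u (1, 1)) ∧
    D (2, 2) = lam ^ 2 * (2 * q * γ * u (0, 0) - 2 * q * γ * u (2, 2) +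
      (s - q * γ) * u (2, 1) + (-s - q * γ) * u (1, 2)) ∧
    D (0, 1) = Complex.I * (M.gap - σ / 2) * u (0, 1) + lam ^ 2 *
      ((-2 * γ - 2 * Complex.I * x) * u (0, 1) + (s - q * γ) * (u (0, 1) + u (0, 2))) ∧
    D (0, 2) = Complex.I * (M.gap + σ / 2) * u (0, 2) + lam ^ 2 *
      ((-2 * γ - 2 * Complex.I * x) * u (0, 2) + (s - q * γ) * (u (0, 1) + u (0, 2))) ∧
    D (1, 0) = -(Complex.I * (M.gap - σ / 2) * u (1, 0)) + lam ^ 2 *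
      ((-2 * γ + 2 * Complex.I * x) * u (1, 0) + (-s - q * γ) * (u (1, 0) + u (2, 0))) ∧
    D (2, 0) = -(Complex.I * (M.gap + σ / 2) * u (2, 0)) + lam ^ 2 *
      ((-2 * γ + 2 * Complex.I * x) * u (2, 0) + (-s - q * γ) * (u (1, 0) + u (2, 0)))

-- Since 0, Δ and -Δ are distinct, each coordinate receives a contribution from exactly one of the
-- three level shift operators; the rest is evaluation of finite sums.
set_option maxHeartbeats 2000000 in
lemma isGenerator_of_boundary_values (hgap : 0 < M.gap) {F : ℝ → ℂ} {γ q x y : ℝ}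
    (hF₁ : F M.gap = 2 * (x - Complex.I * γ)) (hF₂ : F (-M.gap) = 2 * (y - Complex.I * (q * γ)))
    (hΛ : ∀ σ lam e, M.levelShift σ lam e = M.shiftEntry F σ lam e) :
    M.IsGenerator γ q x y := by
  intro σ lam u
  have b00 : M.bohr (0, 0) = 0 := by simp [bohr]
  have b11 : M.bohr (1, 1) = 0 := by simp [bohr]
  have b12 : M.bohr (1, 2) = 0 := by simp [bohr, levels]
  have b21 : M.bohr (2, 1) = 0 := by simp [bohr, levels]
  have b22 : M.bohr (2, 2) = 0 := by simp [bohr]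
  have b01 : M.bohr (0, 1) = M.gap := by simp [bohr, levels, gap]
  have b02 : M.bohr (0, 2) = M.gap := by simp [bohr, levels, gap]
  have b10 : M.bohr (1, 0) = -M.gap := by simp [bohr, levels, gap]
  have b20 : M.bohr (2, 0) = -M.gap := by simp [bohr, levels, gap]
  have h1 : M.gap ≠ 0 := hgap.ne'
  have h2 : M.gap ≠ -M.gap := by linarith
  have h3 : -M.gap ≠ M.gap := by linarith
  have l0 : M.levels σ 0 = M.E + M.gap := by simp [levels, gap]
  have l1 : M.levels σ 1 = M.E + σ / 2 := by simp [levels]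
  have l2 : M.levels σ 2 = M.E - σ / 2 := by simp [levels]
  have hI := Complex.I_sq
  have hc : (starRingEnd ℂ) 2 = 2 := map_ofNat _ 2
  refine ⟨?_, ?_, ?_, ?_, ?_, ?_, ?_, ?_, ?_⟩ <;>
  · simp [Matrix.mulVec, dotProduct, totalLevelShift, hΛ, shiftEntry, secondOrder,
      couplingCommutator, Fintype.sum_prod_type, Fin.sum_univ_three, couplingMatrix, hc,
      b00, b11, b12, b21, b22, b01, b02, b10, b20, h1, h2, h3, h1.symm, Pi.single_apply, hF₁, hF₂,
      l0, l1, l2]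
    ring_nf
    simp only [hI]
    ring

end Model

/-! ### Lyapunov estimates for the slow-fast system -/

lemma le_mul_exp_of_hasDerivAt_le {V V' : ℝ → ℝ} {k : ℝ} (hV : ∀ t, HasDerivAt V (V' t) t)
    (hle : ∀ t, V' t ≤ -k * V t) {t : ℝ} (ht : 0 ≤ t) : V t ≤ V 0 * Real.exp (-k * t) := by
  have hd : ∀ t, HasDerivAt (fun t => V t * Real.exp (k * t))
      (V' t * Real.exp (k * t) + V t * (Real.exp (k * t) * k)) t := fun t =>
    (hV t).mul (by simpa using ((hasDerivAt_id t).const_mul k).exp)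
  have ha : Antitone fun t => V t * Real.exp (k * t) := by
    refine antitone_of_deriv_nonpos (fun t => (hd t).differentiableAt) fun t => ?_
    rw [(hd t).deriv]
    have : V' t * Real.exp (k * t) + V t * (Real.exp (k * t) * k) =
        (V' t + k * V t) * Real.exp (k * t) := by ring
    rw [this]
    exact mul_nonpos_of_nonpos_of_nonneg (by linarith [hle t]) (Real.exp_pos _).le
  have h := ha ht
  simp only [mul_zero, Real.exp_zero, mul_one] at h
  have h2 : V t = V t * Real.exp (k * t) * Real.exp (-k * t) := by
    rw [mul_assoc, ← Real.exp_add]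
    simp
  rw [h2]
  gcongr

/-- Completion of squares for a fast block with rate `α`, coupled with strength `s` to a slow
variable `R` with rate `δ s²`. -/
lemma exists_lyapunov_weight {α δ K : ℝ} (hα : 0 < α) (hδ : 0 < δ) (hK : 0 < K) :
    ∃ W > 0, ∃ κ > 0, κ ≤ 1 ∧ ∃ c > 0, ∀ s, 0 < s → s < κ → ∀ P Y Z R : ℝ,
      W * (-α * (P ^ 2 + Y ^ 2 + Z ^ 2) +
          (P + Y + Z) * (s * K * (P + Y + Z) + s ^ 2 * K * R)) -
        δ * s ^ 2 * R ^ 2 + s * R * (P + Y + Z) ≤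
      -c * s ^ 2 * (W * (P ^ 2 + Y ^ 2 + Z ^ 2) + R ^ 2) := by
  -- With N = P + Y + Z and N² ≤ 3F, the value 12 makes N²/δ ≤ WαF/4, so the order s coupling to R
  -- costs a quarter of each dissipation term.
  obtain ⟨W, hW, hWe⟩ : ∃ W > 0, W * α * δ = 12 :=
    ⟨12 / (α * δ), by positivity, by field_simp⟩
  -- The two bounds on s make each K term cost at most WαF/8, the second one with a further quarter
  -- of the R dissipation. Half of both dissipation terms is left, whence c.
  refine ⟨W, hW, min 1 (min (α / (24 * K)) (α * δ / (24 * W * K ^ 2))), by positivity,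
    min_le_left _ _, min (α / 2) (δ / 2), by positivity, fun s hs hsκ P Y Z R => ?_⟩
  have h1 : s < 1 := hsκ.trans_le (min_le_left _ _)
  have h2 : 24 * K * s ≤ α := by
    have := (hsκ.trans_le ((min_le_right _ _).trans (min_le_left _ _))).le
    rw [le_div_iff₀ (by positivity)] at this
    linarith
  have h3 : 24 * W * K ^ 2 * s ^ 2 ≤ α * δ := by
    have := (hsκ.trans_le ((min_le_right _ _).trans (min_le_right _ _))).le
    rw [le_div_iff₀ (by positivity)] at this
    calc 24 * W * K ^ 2 * s ^ 2 = s * (s * (24 * W * K ^ 2)) := by ring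
      _ ≤ 1 * (s * (24 * W * K ^ 2)) := by gcongr
      _ ≤ α * δ := by linarith
  set F := P ^ 2 + Y ^ 2 + Z ^ 2 with hF
  set N := P + Y + Z with hN
  have hF0 : 0 ≤ F := by positivity
  have hNF : N ^ 2 ≤ 3 * F := by
    nlinarith [sq_nonneg (P - Y), sq_nonneg (P - Z), sq_nonneg (Y - Z)]
  have h4 : s * R * N ≤ δ * s ^ 2 * R ^ 2 / 4 + W * α * F / 4 := by
    have e1 : N ^ 2 / δ ≤ W * α * F / 4 := by
      rw [div_le_iff₀ hδ]
      have : W * α * F / 4 * δ = 3 * F := by linear_combination F / 4 * hWe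
      rw [this]
      exact hNF
    have e2 : s * R * N ≤ δ * s ^ 2 * R ^ 2 / 4 + N ^ 2 / δ := by
      have : 0 ≤ (δ * s * R / 2 - N) ^ 2 / δ := by positivity
      have e3 : (δ * s * R / 2 - N) ^ 2 / δ = δ * s ^ 2 * R ^ 2 / 4 + N ^ 2 / δ - s * R * N := by
        field_simp
        ring
      linarith
    linarith
  have h5 : W * (s ^ 2 * K * R * N) ≤ δ * s ^ 2 * R ^ 2 / 4 + W * α * F / 8 := by
    have e2 : W * (s ^ 2 * K * R * N) ≤
        δ * s ^ 2 * R ^ 2 / 4 + W ^ 2 * s ^ 2 * K ^ 2 * N ^ 2 / δ := by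
      have : 0 ≤ (δ * s * R / 2 - W * s * K * N) ^ 2 / δ := by positivity
      have e3 : (δ * s * R / 2 - W * s * K * N) ^ 2 / δ =
          δ * s ^ 2 * R ^ 2 / 4 + W ^ 2 * s ^ 2 * K ^ 2 * N ^ 2 / δ -
            W * (s ^ 2 * K * R * N) := by
        field_simp
        ring
      linarith
    have e1 : W ^ 2 * s ^ 2 * K ^ 2 * N ^ 2 / δ ≤ W * α * F / 8 := by
      rw [div_le_iff₀ hδ]
      calc W ^ 2 * s ^ 2 * K ^ 2 * N ^ 2 = W / 24 * (24 * W * K ^ 2 * s ^ 2) * N ^ 2 := by ring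
        _ ≤ W / 24 * (α * δ) * (3 * F) := by gcongr
        _ = W * α * F / 8 * δ := by ring
    linarith
  have h6 : W * (s * K * N * N) ≤ W * α * F / 8 := by
    calc W * (s * K * N * N) = W / 24 * (24 * K * s) * N ^ 2 := by ring
      _ ≤ W / 24 * α * (3 * F) := by gcongr
      _ = W * α * F / 8 := by ring
  have h7 : min (α / 2) (δ / 2) * s ^ 2 * (W * F + R ^ 2) ≤
      α / 2 * (W * F) + δ / 2 * s ^ 2 * R ^ 2 := by
    have e1 : min (α / 2) (δ / 2) * s ^ 2 * (W * F) ≤ α / 2 * 1 * (W * F) := by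
      gcongr
      · exact min_le_left _ _
      · nlinarith
    have e2 : min (α / 2) (δ / 2) * s ^ 2 * R ^ 2 ≤ δ / 2 * s ^ 2 * R ^ 2 := by
      gcongr
      exact min_le_right _ _
    linarith
  nlinarith

lemma inner_mul_self_add (c z w : ℂ) :
    inner ℝ z (c * z + w) ≤ c.re * ‖z‖ ^ 2 + ‖z‖ * ‖w‖ := by
  rw [inner_add_right]
  have h1 : inner ℝ z (c * z) = c.re * ‖z‖ ^ 2 := by
    rw [Complex.inner, ← Complex.normSq_eq_norm_sq, Complex.normSq_apply]
    simp
    ring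
  rw [h1]
  gcongr
  exact real_inner_le_norm z w

set_option maxHeartbeats 1000000 in
/-- The dissipation inequality for the linear system that governs the degenerate levels, in
variables adapted to the slow manifold. -/
lemma exists_dissipation {γ q : ℝ} (hγ : 0 < γ) (hq : 0 < q) (ξ : ℝ) :
    ∃ η : ℂ, 4 * (q * γ + Complex.I * ξ) * η = Complex.I ∧
    ∃ W > 0, ∃ κ > 0, κ ≤ 1 ∧ ∃ c > 0, ∀ s : ℝ, 0 < s → s < κ → ∀ p Y Z R p' Y' Z' R' : ℂ,
      R' = Complex.I * s * ((2 + q) / (2 * (1 + q)) : ℝ) *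
        (Y - Z + s * (η - (starRingEnd ℂ) η) * R) →
      p' = (-4 * γ * (1 + q) : ℝ) * p -
        Complex.I * s / 2 * (Y - Z + s * (η - (starRingEnd ℂ) η) * R) →
      Y' = -2 * (q * γ + Complex.I * ξ) * Y -
        Complex.I * s / 2 * (q / (1 + q) : ℝ) * p - s * η * R' →
      Z' = -2 * (q * γ - Complex.I * ξ) * Z +
        Complex.I * s / 2 * (q / (1 + q) : ℝ) * p - s * (starRingEnd ℂ) η * R' →
      W * (inner ℝ p p' + inner ℝ Y Y' + inner ℝ Z Z') + inner ℝ R R' ≤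
        -c * s ^ 2 * (W * (‖p‖ ^ 2 + ‖Y‖ ^ 2 + ‖Z‖ ^ 2) + ‖R‖ ^ 2) := by
  set n := (q * γ) ^ 2 + ξ ^ 2 with hn
  have hn0 : 0 < n := by positivity
  set b := q * γ / (4 * n) with hb
  -- This is i/(4(qγ + iξ)) split into real and imaginary parts. Positivity of the imaginary part b
  -- produces the slow decay.
  set η : ℂ := (ξ / (4 * n) : ℝ) + Complex.I * b with hη
  have hb0 : 0 < b := by positivity
  have hηη : η - (starRingEnd ℂ) η = 2 * Complex.I * b := by
    simp only [hη, map_add, map_mul, Complex.conj_ofReal, Complex.conj_I]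
    ring
  set m := (2 + q) / (2 * (1 + q)) with hm
  set k := q / (1 + q) with hk
  have hm0 : 0 < m := by positivity
  have hm1 : m ≤ 1 := by rw [hm, div_le_one (by positivity)]; linarith
  have hk0 : 0 < k := by positivity
  have hk1 : k ≤ 1 := by rw [hk, div_le_one (by positivity)]; linarith
  set e := ‖η‖ with he
  have he0 : 0 ≤ e := norm_nonneg _
  -- K dominates every forcing coefficient of the fast variables: the direct couplings, and the
  -- contribution of sηR' to Y' and Z'.
  set K := 1 + e + 2 * e * b + b with hK
  obtain ⟨W, hW, κ, hκ, hκ1, c, hc, hmain⟩ :=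
    exists_lyapunov_weight (α := 2 * q * γ) (δ := 2 * m * b) (K := K)
      (by positivity) (by positivity) (by positivity)
  refine ⟨η, ?_, W, hW, κ, hκ, hκ1, c, hc, ?_⟩
  · rw [hη, hb]
    have : (n : ℂ) ≠ 0 := by exact_mod_cast hn0.ne'
    push_cast
    field_simp
    rw [hn]
    push_cast
    ring_nf
    simp only [Complex.I_sq]
    ring
  intro s hs hsκ p Y Z R p' Y' Z' R' hR' hp' hY' hZ'
  have hs1 : s ≤ 1 := hsκ.le.trans hκ1
  have key := hmain s hs hsκ ‖p‖ ‖Y‖ ‖Z‖ ‖R‖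
  have hYZ : ‖Y - Z‖ ≤ ‖Y‖ + ‖Z‖ := norm_sub_le _ _
  have hP0 := norm_nonneg p
  have hY0 := norm_nonneg Y
  have hZ0 := norm_nonneg Z
  have hR0 := norm_nonneg R
  rw [hηη] at hR' hp'
  -- The slow dissipation appears: is·m·s(η - η̄)R equals -2mbs²R.
  have hR2 : R' = (-2 * m * b * s ^ 2 : ℝ) * R + Complex.I * s * m * (Y - Z) := by
    rw [hR']
    push_cast
    linear_combination (2 * s ^ 2 * m * b * R) * Complex.I_sq
  have hp2 : p' = (-4 * γ * (1 + q) : ℝ) * p +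
      (-(Complex.I * s / 2 * (Y - Z)) + s ^ 2 * b * R) := by
    rw [hp']
    linear_combination (-(s ^ 2 * b * R)) * Complex.I_sq
  have nR : ‖R'‖ ≤ s * (‖p‖ + ‖Y‖ + ‖Z‖) + 2 * b * s ^ 2 * ‖R‖ := by
    rw [hR2]
    refine (norm_add_le _ _).trans ?_
    have e1 : ‖((-2 * m * b * s ^ 2 : ℝ) : ℂ) * R‖ = m * (2 * b * s ^ 2 * ‖R‖) := by
      rw [norm_mul, Complex.norm_real, Real.norm_eq_abs, show -2 * m * b * s ^ 2 =
        -(2 * m * b * s ^ 2) by ring, abs_neg, abs_of_pos (by positivity)]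
      ring
    have e2 : ‖Complex.I * s * m * (Y - Z)‖ = m * (s * ‖Y - Z‖) := by
      simp [abs_of_pos hs, abs_of_pos hm0]
      ring
    rw [e1, e2]
    have e3 : m * (2 * b * s ^ 2 * ‖R‖) ≤ 1 * (2 * b * s ^ 2 * ‖R‖) := by gcongr
    have e4 : m * (s * ‖Y - Z‖) ≤ 1 * (s * (‖p‖ + ‖Y‖ + ‖Z‖)) := by gcongr; linarith
    linarith
  have iR : inner ℝ R R' ≤ -(2 * m * b) * s ^ 2 * ‖R‖ ^ 2 + s * ‖R‖ * (‖p‖ + ‖Y‖ + ‖Z‖) := by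
    rw [hR2]
    refine (inner_mul_self_add _ _ _).trans ?_
    have e2 : ‖Complex.I * s * m * (Y - Z)‖ ≤ 1 * (s * (‖p‖ + ‖Y‖ + ‖Z‖)) := by
      have : ‖Complex.I * s * m * (Y - Z)‖ = m * (s * ‖Y - Z‖) := by
        simp [abs_of_pos hs, abs_of_pos hm0]
        ring
      rw [this]
      gcongr
      linarith
    rw [Complex.ofReal_re]
    nlinarith [mul_le_mul_of_nonneg_left e2 hR0]
  set N := ‖p‖ + ‖Y‖ + ‖Z‖ with hN
  have hN0 : 0 ≤ N := by positivity
  set T := s * K * N + s ^ 2 * K * ‖R‖ with hT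
  have hT0 : 0 ≤ T := by positivity
  have ip : inner ℝ p p' ≤ -(2 * q * γ) * ‖p‖ ^ 2 + ‖p‖ * T := by
    rw [hp2]
    refine (inner_mul_self_add _ _ _).trans ?_
    have e1 : ‖-(Complex.I * s / 2 * (Y - Z)) + s ^ 2 * b * R‖ ≤ T := by
      refine (norm_add_le _ _).trans ?_
      have e2 : ‖-(Complex.I * s / 2 * (Y - Z))‖ = s / 2 * ‖Y - Z‖ := by
        simp [abs_of_pos hs]
      have e3 : ‖(s ^ 2 * b * R : ℂ)‖ = s ^ 2 * b * ‖R‖ := by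
        simp [abs_of_pos hs, abs_of_pos hb0]
      rw [e2, e3, hT]
      have e4 : s / 2 * ‖Y - Z‖ ≤ s * K * N := by
        have : s / 2 * ‖Y - Z‖ ≤ s * 1 * N := by
          calc s / 2 * ‖Y - Z‖ ≤ s * N := by gcongr <;> linarith
            _ = s * 1 * N := by ring
        refine this.trans ?_
        gcongr
        have : 0 ≤ e + 2 * e * b + b := by positivity
        linarith
      have e5 : b ≤ K := by
        have : 0 ≤ 1 + e + 2 * e * b := by positivity
        linarith
      have e6 : s ^ 2 * b * ‖R‖ ≤ s ^ 2 * K * ‖R‖ := by gcongr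
      linarith
    rw [Complex.ofReal_re]
    -- The weaker rate 2qγ of Y and Z serves as common rate for the fast block.
    have e7 : -4 * γ * (1 + q) * ‖p‖ ^ 2 ≤ -(2 * q * γ) * ‖p‖ ^ 2 := by
      gcongr
      nlinarith [mul_pos hγ hq]
    have := mul_le_mul_of_nonneg_left e1 hP0
    linarith
  have hw : ∀ w : ℂ, ‖w‖ = s / 2 * (k * ‖p‖) → ∀ ζ : ℂ, ‖ζ‖ = e →
      ‖w - s * ζ * R'‖ ≤ T := by
    intro w hw ζ hζ
    refine (norm_sub_le _ _).trans ?_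
    have e1 : ‖s * ζ * R'‖ = s * e * ‖R'‖ := by simp [abs_of_pos hs, hζ]
    rw [hw, e1]
    have e2 : s * e * ‖R'‖ ≤ s * e * N + s ^ 2 * (2 * e * b) * ‖R‖ := by
      calc s * e * ‖R'‖ ≤ s * e * (s * N + 2 * b * s ^ 2 * ‖R‖) := by gcongr
        _ = s * (s * (e * N)) + s * (s ^ 2 * (2 * e * b) * ‖R‖) := by ring
        _ ≤ s * (1 * (e * N)) + 1 * (s ^ 2 * (2 * e * b) * ‖R‖) := by gcongr
        _ = _ := by ring
    have e3 : s / 2 * (k * ‖p‖) ≤ s * (1 * N) := by gcongr <;> linarith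
    have e4 : s * (1 * N) + s * e * N ≤ s * K * N := by
      have : 0 ≤ s * (2 * e * b + b) * N := by positivity
      rw [hK]
      linarith
    have e5 : s ^ 2 * (2 * e * b) * ‖R‖ ≤ s ^ 2 * K * ‖R‖ := by
      gcongr
      have : 0 ≤ 1 + e + b := by positivity
      linarith
    linarith
  have iY : inner ℝ Y Y' ≤ -(2 * q * γ) * ‖Y‖ ^ 2 + ‖Y‖ * T := by
    rw [hY', sub_sub, sub_eq_add_neg]
    refine (inner_mul_self_add _ _ _).trans ?_
    have e0 : -(Complex.I * s / 2 * k * p + s * η * R') =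
      -(Complex.I * s / 2 * k * p) - s * η * R' := by ring
    have e1 := hw (-(Complex.I * s / 2 * k * p))
      (by simp [abs_of_pos hs, abs_of_pos hk0]; ring) η rfl
    rw [e0]
    have e2 := mul_le_mul_of_nonneg_left e1 hY0
    have e3 : (-2 * (q * γ + Complex.I * ξ) : ℂ).re = -(2 * q * γ) := by simp; ring
    rw [e3]
    linarith
  have iZ : inner ℝ Z Z' ≤ -(2 * q * γ) * ‖Z‖ ^ 2 + ‖Z‖ * T := by
    rw [hZ', add_sub_assoc]
    refine (inner_mul_self_add _ _ _).trans ?_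
    have e1 := hw (Complex.I * s / 2 * k * p)
      (by simp [abs_of_pos hs, abs_of_pos hk0]; ring) ((starRingEnd ℂ) η) (Complex.norm_conj η)
    have e2 := mul_le_mul_of_nonneg_left e1 hZ0
    have e3 : (-2 * (q * γ - Complex.I * ξ) : ℂ).re = -(2 * q * γ) := by simp; ring
    rw [e3]
    linarith
  have hsum : inner ℝ p p' + inner ℝ Y Y' + inner ℝ Z Z' ≤
      -(2 * q * γ) * (‖p‖ ^ 2 + ‖Y‖ ^ 2 + ‖Z‖ ^ 2) + N * T := by
    rw [hN]
    linarith
  have hsumW := mul_le_mul_of_nonneg_left hsum hW.le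
  linarith

lemma hasDerivAt_norm_sq_smul {f : ℝ → ℂ} {f' : ℂ} {μ t : ℝ}
    (hf : HasDerivAt f (μ * f') t) :
    HasDerivAt (fun t => ‖f t‖ ^ 2) (2 * μ * inner ℝ (f t) f') t := by
  have h := hf.norm_sq
  rw [← Complex.real_smul, inner_smul_right, ← mul_assoc] at h
  exact h

/-! ### Relaxation of the two kinds of matrix elements -/

/-- Decay of the coherences between the upper level and the two lower ones. -/
lemma norm_le_of_coherence_equation {f g : ℝ → ℂ} {a b x y γ r μ : ℝ} (hr : 0 ≤ r)
    (hμ : 0 < μ)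
    (hf : ∀ t, HasDerivAt f (Complex.I * a * f t + μ * ((-2 * γ + Complex.I * x) * f t +
      (Complex.I * y - r) * (f t + g t))) t)
    (hg : ∀ t, HasDerivAt g (Complex.I * b * g t + μ * ((-2 * γ + Complex.I * x) * g t +
      (Complex.I * y - r) * (f t + g t))) t) {t : ℝ} (ht : 0 ≤ t) :
    ‖f t‖ ≤ (‖f 0‖ + ‖g 0‖) * Real.exp (-(2 * γ * μ) * t) := by
  have hV : ∀ t, HasDerivAt (fun t => ‖f t‖ ^ 2 + ‖g t‖ ^ 2) _ t := fun t =>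
    ((hf t).norm_sq).add ((hg t).norm_sq)
  have hre : ∀ z w v : ℂ, ∀ a : ℝ, inner ℝ z (Complex.I * a * z + μ * ((-2 * γ + Complex.I * x) * z +
      (Complex.I * y - r) * w)) = μ * (-2 * γ * ‖z‖ ^ 2 + inner ℝ z ((Complex.I * y - r) * w)) := by
    intro z w v a
    simp only [Complex.inner, ← Complex.normSq_eq_norm_sq, Complex.normSq_apply]
    simp
    ring
  have hdec := le_mul_exp_of_hasDerivAt_le (k := 4 * γ * μ) hV (fun t => by
    rw [hre _ _ 0, hre _ _ 0]
    -- The coupling acts through f + g in both equations, so the sum is a quadratic form in f + g: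
    -- the part iy drops out and -r has a favourable sign.
    have h1 : inner ℝ (f t) ((Complex.I * y - r) * (f t + g t)) +
        inner ℝ (g t) ((Complex.I * y - r) * (f t + g t)) = -r * ‖f t + g t‖ ^ 2 := by
      rw [← inner_add_left]
      simp only [Complex.inner, ← Complex.normSq_eq_norm_sq, Complex.normSq_apply]
      simp
      ring
    have h2 : 0 ≤ μ * (r * ‖f t + g t‖ ^ 2) := by positivity
    linear_combination 2 * μ * h1 + 2 * h2) ht
  have h1 : ‖f t‖ ^ 2 ≤ ((‖f 0‖ + ‖g 0‖) * Real.exp (-(2 * γ * μ) * t)) ^ 2 := by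
    rw [mul_pow, ← Real.exp_nat_mul]
    have e1 : ((2 : ℕ) : ℝ) * (-(2 * γ * μ) * t) = -(4 * γ * μ) * t := by push_cast; ring
    rw [e1]
    have e2 : ‖f 0‖ ^ 2 + ‖g 0‖ ^ 2 ≤ (‖f 0‖ + ‖g 0‖) ^ 2 := by
      nlinarith [mul_nonneg (norm_nonneg (f 0)) (norm_nonneg (g 0))]
    calc ‖f t‖ ^ 2 ≤ ‖f t‖ ^ 2 + ‖g t‖ ^ 2 := le_add_of_nonneg_right (by positivity)
      _ ≤ _ := hdec
      _ ≤ _ := by gcongr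
  exact le_of_sq_le_sq h1 (by positivity)

set_option maxHeartbeats 1000000 in
/-- Relaxation of the populations and of the coherence of the two lower levels. -/
lemma exists_decay {γ q : ℝ} (hγ : 0 < γ) (hq : 0 < q) (ξ : ℝ) :
    ∃ κ > 0, κ ≤ 1 ∧ ∃ C > 0, ∃ c > 0, ∀ μ σ : ℝ, 0 < μ → 0 < σ → σ < κ * μ →
      ∀ u00 u11 u12 u21 u22 : ℝ → ℂ,
      (∀ t, HasDerivAt u00 (μ * (-4 * γ * u00 t + 2 * γ * (u11 t + u12 t + u21 t + u22 t))) t) →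
      (∀ t, HasDerivAt u11 (μ * (2 * q * γ * u00 t - 2 * q * γ * u11 t +
        (Complex.I * ξ - q * γ) * u12 t + (-(Complex.I * ξ) - q * γ) * u21 t)) t) →
      (∀ t, HasDerivAt u12 (Complex.I * σ * u12 t + μ * (2 * q * γ * u00 t - 2 * q * γ * u12 t +
        (Complex.I * ξ - q * γ) * u11 t + (-(Complex.I * ξ) - q * γ) * u22 t)) t) →
      (∀ t, HasDerivAt u21 (-(Complex.I * σ * u21 t) + μ * (2 * q * γ * u00 t -
        2 * q * γ * u21 t + (Complex.I * ξ - q * γ) * u22 t +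
        (-(Complex.I * ξ) - q * γ) * u11 t)) t) →
      (∀ t, HasDerivAt u22 (μ * (2 * q * γ * u00 t - 2 * q * γ * u22 t +
        (Complex.I * ξ - q * γ) * u21 t + (-(Complex.I * ξ) - q * γ) * u12 t)) t) →
      ∀ B : ℝ, ‖u00 0‖ ≤ B → ‖u11 0‖ ≤ B → ‖u12 0‖ ≤ B → ‖u21 0‖ ≤ B → ‖u22 0‖ ≤ B →
      ∀ t, 0 ≤ t →
        let m := (q * u00 0 + u11 0 + u22 0) / (q + 2)
        let ε := C * B * Real.exp (-c * t * σ ^ 2 / μ)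
        ‖u00 t - m‖ ≤ ε ∧ ‖u11 t - m‖ ≤ ε ∧ ‖u22 t - m‖ ≤ ε ∧ ‖u12 t‖ ≤ ε ∧ ‖u21 t‖ ≤ ε := by
  obtain ⟨η, hη, W, hW, κ, hκ, hκ1, c, hc, hdiss⟩ := exists_dissipation hγ hq ξ
  set e := ‖η‖ with he
  have he0 : 0 ≤ e := norm_nonneg _
  -- The numbers are the squares of the initial bounds 3B for p, (2 + 7e)B for Y and Z, and 7B for
  -- R.
  set C₀ := W * (9 + 2 * (2 + 7 * e) ^ 2) + 49 with hC₀
  have hC₀' : 0 < C₀ := by positivity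
  set C₁ := √C₀ * (1 + (√W)⁻¹) with hC₁
  have hC₁' : 0 < C₁ := by positivity
  refine ⟨κ, hκ, hκ1, 20 * (1 + e) * C₁, by positivity, c, hc, ?_⟩
  intro μ σ hμ hσ hσκ u00 u11 u12 u21 u22 h00 h11 h12 h21 h22 B b00 b11 b12 b21 b22 t ht
  have hB : 0 ≤ B := (norm_nonneg _).trans b00
  obtain ⟨s, hs, hsκ, hsσ⟩ : ∃ s > 0, s < κ ∧ σ = s * μ :=
    ⟨σ / μ, by positivity, by rwa [div_lt_iff₀ hμ], by field_simp⟩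
  have hs1 : s ≤ 1 := hsκ.le.trans hκ1
  have hq2 : (q + 2 : ℂ) ≠ 0 := by exact_mod_cast (by positivity : (q + 2 : ℝ) ≠ 0)
  have hq1 : (1 + q : ℂ) ≠ 0 := by exact_mod_cast (by positivity : (1 + q : ℝ) ≠ 0)
  set k : ℂ := ((q / (1 + q) : ℝ) : ℂ) with hk
  set m' : ℂ := (((2 + q) / (2 * (1 + q)) : ℝ) : ℂ) with hm'
  have hkq : k * (1 + q) = q := by rw [hk]; push_cast; field_simp
  have hmk : m' = 1 - k / 2 := by rw [hm', hk]; push_cast; field_simp; ring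
  have hk1 : ‖k‖ ≤ 1 := by
    rw [hk, Complex.norm_real, Real.norm_of_nonneg (by positivity), div_le_one (by positivity)]
    linarith
  have hη' : 4 * (q * γ - Complex.I * ξ) * (starRingEnd ℂ) η = -Complex.I := by
    have := congrArg (starRingEnd ℂ) hη
    simp only [map_mul, map_add, Complex.conj_ofReal, Complex.conj_I, map_ofNat] at this
    rw [← this]
    ring
  set η' := (starRingEnd ℂ) η with hη'd
  have hη'n : ‖η'‖ = e := Complex.norm_conj η
  -- Matrix elements in the basis (φ₂ ± φ₃)/√2: x is the bright and d the dark diagonal entry, y and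
  -- z are the coherences between them.
  let x : ℝ → ℂ := fun t => (u11 t + u12 t + u21 t + u22 t) / 2
  let d : ℝ → ℂ := fun t => (u11 t - u12 t - u21 t + u22 t) / 2
  let y : ℝ → ℂ := fun t => (u11 t - u12 t + u21 t - u22 t) / 2
  let z : ℝ → ℂ := fun t => (u11 t + u12 t - u21 t - u22 t) / 2
  let p : ℝ → ℂ := fun t => x t - u00 t
  -- At σ = 0, x' = -4qγμp and p' = -4γ(1 + q)μp, so k = q/(1 + q) makes R a constant of motion. Y
  -- and Z below measure the distance of the coherences from their quasi-static values.
  let R : ℝ → ℂ := fun t => d t - x t + k * p t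
  let Y : ℝ → ℂ := fun t => y t - s * η * R t
  let Z : ℝ → ℂ := fun t => z t - s * η' * R t
  have hx : ∀ t, HasDerivAt x _ t := fun t =>
    ((((h11 t).add (h12 t)).add (h21 t)).add (h22 t)).div_const 2
  have hd : ∀ t, HasDerivAt d _ t := fun t =>
    ((((h11 t).sub (h12 t)).sub (h21 t)).add (h22 t)).div_const 2
  have hy : ∀ t, HasDerivAt y _ t := fun t =>
    ((((h11 t).sub (h12 t)).add (h21 t)).sub (h22 t)).div_const 2
  have hz : ∀ t, HasDerivAt z _ t := fun t =>
    ((((h11 t).add (h12 t)).sub (h21 t)).sub (h22 t)).div_const 2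
  let R' : ℝ → ℂ := fun t => Complex.I * s * m' * (Y t - Z t + s * (η - η') * R t)
  let p' : ℝ → ℂ := fun t => (-4 * γ * (1 + q) : ℝ) * p t -
    Complex.I * s / 2 * (Y t - Z t + s * (η - η') * R t)
  let Y' : ℝ → ℂ := fun t => -2 * (q * γ + Complex.I * ξ) * Y t -
    Complex.I * s / 2 * k * p t - s * η * R' t
  let Z' : ℝ → ℂ := fun t => -2 * (q * γ - Complex.I * ξ) * Z t +
    Complex.I * s / 2 * k * p t - s * η' * R' t
  have hp : ∀ t, HasDerivAt p (μ * p' t) t := fun t =>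
    ((hx t).sub (h00 t)).congr_deriv (by
      simp only [p', p, Y, Z, y, z, x, hsσ]
      push_cast
      ring)
  have hR : ∀ t, HasDerivAt R (μ * R' t) t := fun t =>
    (((hd t).sub (hx t)).add ((hp t).const_mul k)).congr_deriv (by
      simp only [R', p', p, Y, Z, y, z, x, hsσ, hmk]
      push_cast
      linear_combination (-4 * μ * γ * ((u11 t + u12 t + u21 t + u22 t) / 2 - u00 t)) * hkq)
  have hY : ∀ t, HasDerivAt Y (μ * Y' t) t := fun t =>
    ((hy t).sub ((hR t).const_mul (s * η))).congr_deriv (by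
      simp only [Y', Y, R, p, y, x, d, hsσ]
      push_cast
      linear_combination (-μ * s / 2 * ((u11 t - u12 t - u21 t + u22 t) / 2 - (u11 t + u12 t + u21 t + u22 t) / 2 +
        k * ((u11 t + u12 t + u21 t + u22 t) / 2 - u00 t))) * hη)
  have hZ : ∀ t, HasDerivAt Z (μ * Z' t) t := fun t =>
    ((hz t).sub ((hR t).const_mul (s * η'))).congr_deriv (by
      simp only [Z', Z, R, p, z, x, d, hsσ]
      push_cast
      linear_combination (-μ * s / 2 * ((u11 t - u12 t - u21 t + u22 t) / 2 - (u11 t + u12 t + u21 t + u22 t) / 2 +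
        k * ((u11 t + u12 t + u21 t + u22 t) / 2 - u00 t))) * hη')
  let V : ℝ → ℝ := fun t => W * (‖p t‖ ^ 2 + ‖Y t‖ ^ 2 + ‖Z t‖ ^ 2) + ‖R t‖ ^ 2
  have hV : ∀ t, HasDerivAt V _ t := fun t =>
    ((((hasDerivAt_norm_sq_smul (hp t)).add (hasDerivAt_norm_sq_smul (hY t))).add
      (hasDerivAt_norm_sq_smul (hZ t))).const_mul W).add (hasDerivAt_norm_sq_smul (hR t))
  have hdec := le_mul_exp_of_hasDerivAt_le (k := 2 * μ * (c * s ^ 2)) hV (fun t => by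
    have h := hdiss s hs hsκ (p t) (Y t) (Z t) (R t) (p' t) (Y' t) (Z' t) (R' t) rfl rfl rfl rfl
    have h2 := mul_le_mul_of_nonneg_left h (by positivity : 0 ≤ 2 * μ)
    simp only [V]
    linarith) ht
  set E := Real.exp (-c * t * σ ^ 2 / μ) with hE
  -- V is quadratic, so its decay factor is the square of the one for the amplitudes; μs² = σ²/μ.
  have hE2 : Real.exp (-(2 * μ * (c * s ^ 2)) * t) = E ^ 2 := by
    rw [hE, ← Real.exp_nat_mul]
    congr 1
    rw [hsσ]
    push_cast
    field_simp
  rw [hE2] at hdec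
  have hE0 : 0 < E := Real.exp_pos _
  have half : ∀ w : ℂ, ‖w / 2‖ = ‖w‖ / 2 := fun w => by rw [norm_div]; norm_num
  have four : ∀ {a b c d : ℂ} {A B C D : ℝ}, ‖a‖ ≤ A → ‖b‖ ≤ B → ‖c‖ ≤ C → ‖d‖ ≤ D →
      ‖(a + b + c + d) / 2‖ ≤ (A + B + C + D) / 2 := fun ha hb hc hd => by
    rw [half]
    gcongr
    exact norm_add₄_le.trans (by gcongr)
  have ng : ∀ {a : ℂ} {A : ℝ}, ‖a‖ ≤ A → ‖-a‖ ≤ A := fun h => by rwa [norm_neg]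
  have bx : ‖x 0‖ ≤ 2 * B := by
    have := four b11 b12 b21 b22
    simp only [x]; linarith
  have bd : ‖d 0‖ ≤ 2 * B := by
    have := four b11 (ng b12) (ng b21) b22
    simp only [d, sub_eq_add_neg]; linarith
  have by' : ‖y 0‖ ≤ 2 * B := by
    have := four b11 (ng b12) b21 (ng b22)
    simp only [y, sub_eq_add_neg]; linarith
  have bz : ‖z 0‖ ≤ 2 * B := by
    have := four b11 b12 (ng b21) (ng b22)
    simp only [z, sub_eq_add_neg]; linarith
  have bp : ‖p 0‖ ≤ 3 * B := (norm_sub_le _ _).trans (by linarith)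
  have bR : ‖R 0‖ ≤ 7 * B := by
    refine (norm_add_le _ _).trans ?_
    have h1 := norm_sub_le (d 0) (x 0)
    have h2 : ‖k * p 0‖ ≤ 1 * (3 * B) := by rw [norm_mul]; gcongr
    linarith
  have hslow : ∀ ζ w : ℂ, ‖ζ‖ = e → ‖s * ζ * w‖ ≤ e * ‖w‖ := by
    intro ζ w hζ
    rw [norm_mul, norm_mul, hζ, Complex.norm_real, Real.norm_of_nonneg hs.le]
    calc s * e * ‖w‖ ≤ 1 * e * ‖w‖ := by gcongr
      _ = e * ‖w‖ := by ring
  have bY : ‖Y 0‖ ≤ (2 + 7 * e) * B := by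
    refine (norm_sub_le _ _).trans ?_
    have h1 := hslow η (R 0) rfl
    have h2 := mul_le_mul_of_nonneg_left bR he0
    linarith
  have bZ : ‖Z 0‖ ≤ (2 + 7 * e) * B := by
    refine (norm_sub_le _ _).trans ?_
    have h1 := hslow η' (R 0) hη'n
    have h2 := mul_le_mul_of_nonneg_left bR he0
    linarith
  have bV : V 0 ≤ C₀ * B ^ 2 := by
    calc V 0 ≤ W * ((3 * B) ^ 2 + ((2 + 7 * e) * B) ^ 2 + ((2 + 7 * e) * B) ^ 2) +
        (7 * B) ^ 2 := by simp only [V]; gcongr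
      _ = C₀ * B ^ 2 := by rw [hC₀]; ring
  have hVt : V t ≤ (√C₀ * (B * E)) ^ 2 := by
    calc V t ≤ V 0 * E ^ 2 := hdec
      _ ≤ C₀ * B ^ 2 * E ^ 2 := by gcongr
      _ = (√C₀ * (B * E)) ^ 2 := by rw [mul_pow, Real.sq_sqrt hC₀'.le]; ring
  set D := C₁ * (B * E) with hD
  have hD0 : 0 ≤ D := by positivity
  have hfast : ∀ w : ℂ, W * ‖w‖ ^ 2 ≤ V t → ‖w‖ ≤ D := by
    intro w hw
    have h1 : (√W * ‖w‖) ^ 2 ≤ (√C₀ * (B * E)) ^ 2 := by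
      rw [mul_pow, Real.sq_sqrt hW.le]
      exact hw.trans hVt
    have h2 : √W * ‖w‖ ≤ √C₀ * (B * E) := le_of_sq_le_sq h1 (by positivity)
    have hW' : 0 < √W := Real.sqrt_pos.2 hW
    have h3 : ‖w‖ ≤ (√W)⁻¹ * (√C₀ * (B * E)) := by rwa [le_inv_mul_iff₀ hW']
    have h4 : 0 ≤ √C₀ * (B * E) := by positivity
    rw [hD, hC₁]
    linarith
  have tp : ‖p t‖ ≤ D := hfast _ (by
    simp only [V]
    have : 0 ≤ W * (‖Y t‖ ^ 2 + ‖Z t‖ ^ 2) + ‖R t‖ ^ 2 := by positivity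
    linarith)
  have tY : ‖Y t‖ ≤ D := hfast _ (by
    simp only [V]
    have : 0 ≤ W * (‖p t‖ ^ 2 + ‖Z t‖ ^ 2) + ‖R t‖ ^ 2 := by positivity
    linarith)
  have tZ : ‖Z t‖ ≤ D := hfast _ (by
    simp only [V]
    have : 0 ≤ W * (‖p t‖ ^ 2 + ‖Y t‖ ^ 2) + ‖R t‖ ^ 2 := by positivity
    linarith)
  have tR : ‖R t‖ ≤ D := by
    have h1 : ‖R t‖ ^ 2 ≤ (√C₀ * (B * E)) ^ 2 := by
      refine le_trans ?_ hVt
      simp only [V]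
      have : 0 ≤ W * (‖p t‖ ^ 2 + ‖Y t‖ ^ 2 + ‖Z t‖ ^ 2) := by positivity
      linarith
    have h2 := le_of_sq_le_sq h1 (by positivity)
    have h4 : 0 ≤ (√W)⁻¹ * (√C₀ * (B * E)) := by positivity
    rw [hD, hC₁]
    linarith
  have ty : ‖y t‖ ≤ (1 + e) * D := by
    have h0 : y t = Y t + s * η * R t := by simp only [Y]; ring
    have h1 := hslow η (R t) rfl
    have h2 := mul_le_mul_of_nonneg_left tR he0
    rw [h0]
    exact (norm_add_le _ _).trans (by linarith)
  have tz : ‖z t‖ ≤ (1 + e) * D := by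
    have h0 : z t = Z t + s * η' * R t := by simp only [Z]; ring
    have h1 := hslow η' (R t) hη'n
    have h2 := mul_le_mul_of_nonneg_left tR he0
    rw [h0]
    exact (norm_add_le _ _).trans (by linarith)
  have tr : ‖d t - x t‖ ≤ 2 * D := by
    have h0 : d t - x t = R t - k * p t := by simp only [R]; ring
    have h2 : ‖k * p t‖ ≤ 1 * D := by rw [norm_mul]; gcongr
    rw [h0]
    exact (norm_sub_le _ _).trans (by linarith)
  -- The unnormalised Gibbs expectation at σ = 0 is conserved for every σ. Together with the decay
  -- of p and d - x it identifies the limit m.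
  have hconst : q * u00 t + u11 t + u22 t = q * u00 0 + u11 0 + u22 0 := by
    have hd0 : ∀ t, HasDerivAt (fun t => q * u00 t + u11 t + u22 t) 0 t := fun t =>
      ((((h00 t).const_mul (q : ℂ)).add (h11 t)).add (h22 t)).congr_deriv (by ring)
    exact is_const_of_deriv_eq_zero (fun t => (hd0 t).differentiableAt)
      (fun t => (hd0 t).deriv) t 0
  intro m ε
  have hm : m * (q + 2) = q * u00 t + u11 t + u22 t := by
    rw [hconst]
    exact div_mul_cancel₀ _ hq2
  have ta : ‖u00 t - m‖ ≤ 2 * D := by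
    have h0 : (q + 2) * (u00 t - m) = -(2 * p t + (d t - x t)) := by
      simp only [p, x, d]
      linear_combination -hm
    have h1 : ‖(q + 2 : ℂ)‖ = q + 2 := by
      rw [show (q + 2 : ℂ) = ((q + 2 : ℝ) : ℂ) by push_cast; rfl, Complex.norm_real,
        Real.norm_of_nonneg (by positivity)]
    have h2 := congrArg norm h0
    rw [norm_mul, h1, norm_neg] at h2
    have h3 : ‖2 * p t + (d t - x t)‖ ≤ 4 * D := by
      refine (norm_add_le _ _).trans ?_
      have : ‖2 * p t‖ = 2 * ‖p t‖ := by simp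
      linarith
    nlinarith [norm_nonneg (u00 t - m)]
  have tx : ‖x t - m‖ ≤ 3 * D := by
    have h0 : x t - m = (u00 t - m) + p t := by simp only [p]; ring
    rw [h0]
    exact (norm_add_le _ _).trans (by linarith)
  have td : ‖d t - m‖ ≤ 5 * D := by
    have h0 : d t - m = (x t - m) + (d t - x t) := by ring
    rw [h0]
    exact (norm_add_le _ _).trans (by linarith)
  have hεD : ε = 20 * (1 + e) * D := by simp only [ε, hD]; ring
  have heD : 0 ≤ e * D := by positivity
  have tdx : ‖x t - d t‖ ≤ 2 * D := by rwa [norm_sub_rev]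
  rw [hεD]
  refine ⟨by linarith, ?_, ?_, ?_, ?_⟩
  · have h0 : u11 t - m = ((x t - m) + (d t - m) + y t + z t) / 2 := by
      simp only [x, d, y, z]; ring
    rw [h0]
    exact (four tx td ty tz).trans (by linarith)
  · have h0 : u22 t - m = ((x t - m) + (d t - m) + -y t + -z t) / 2 := by
      simp only [x, d, y, z]; ring
    rw [h0]
    exact (four tx td (ng ty) (ng tz)).trans (by linarith)
  · have h0 : u12 t = ((x t - d t) + -y t + z t + 0) / 2 := by
      simp only [x, d, y, z]; ring
    rw [h0]
    exact (four tdx (ng ty) tz norm_zero.le).trans (by linarith)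
  · have h0 : u21 t = ((x t - d t) + y t + -z t + 0) / 2 := by
      simp only [x, d, y, z]; ring
    rw [h0]
    exact (four tdx ty (ng tz) norm_zero.le).trans (by linarith)

/-! ### Entry bounds for density matrices and the trace norm -/

lemma IsDensityMatrix.norm_apply_le_one {ρ : Matrix (Fin 3) (Fin 3) ℂ} (hρ : IsDensityMatrix ρ)
    (i j : Fin 3) : ‖ρ i j‖ ≤ 1 := by
  obtain ⟨hpos, htr⟩ := hρ
  have hdiag : ∀ i, 0 ≤ ρ i i := fun i => hpos.diag_nonneg
  have hre : ∀ i, ρ i i = ((ρ i i).re : ℂ) := fun i =>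
    Complex.ext rfl (by simpa using ((Complex.le_def.1 (hdiag i)).2).symm)
  have hre0 : ∀ i, 0 ≤ (ρ i i).re := fun i => (Complex.le_def.1 (hdiag i)).1
  have hre1 : ∀ i, (ρ i i).re ≤ 1 := by
    have h1 : ∑ i, (ρ i i).re = 1 := by
      have := congrArg Complex.re htr
      simpa [Matrix.trace] using this
    intro i
    rw [← h1]
    exact Finset.single_le_sum (f := fun i => (ρ i i).re) (fun i _ => hre0 i) (Finset.mem_univ i)
  -- Nonnegativity of the 2 × 2 minor reads |ρ_ij|² ≤ ρ_ii ρ_jj. It also holds for i = j, where the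
  -- submatrix has repeated indices.
  have hdet := (hpos.submatrix ![i, j]).det_nonneg
  have hji : ρ j i = (starRingEnd ℂ) (ρ i j) := (hpos.isHermitian.apply j i).symm
  rw [Matrix.det_fin_two] at hdet
  simp only [Matrix.submatrix_apply, Matrix.cons_val_zero, Matrix.cons_val_one, hji] at hdet
  rw [Complex.mul_conj', hre i, hre j] at hdet
  norm_cast at hdet
  have h2 : ‖ρ i j‖ ^ 2 ≤ 1 ^ 2 := by nlinarith [hre0 i, hre0 j, hre1 i, hre1 j]
  exact le_of_sq_le_sq h2 zero_le_one

/-- Each of the three singular values is at most the Hilbert-Schmidt norm, which is at most 3a. -/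
lemma traceNorm_le_of_norm_apply_le {A : Matrix (Fin 3) (Fin 3) ℂ} {a : ℝ}
    (hA : ∀ i j, ‖A i j‖ ≤ a) : traceNorm A ≤ 9 * a := by
  have ha : 0 ≤ a := (norm_nonneg _).trans (hA 0 0)
  set h := Matrix.isHermitian_conjTranspose_mul_self A
  have hnn : ∀ i, 0 ≤ h.eigenvalues i :=
    (Matrix.posSemidef_conjTranspose_mul_self A).eigenvalues_nonneg
  have hsum : ∑ i, h.eigenvalues i = ∑ i, ∑ j, ‖A j i‖ ^ 2 := by
    have := h.trace_eq_sum_eigenvalues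
    have h2 : (A.conjTranspose * A).trace = ((∑ i, ∑ j, ‖A j i‖ ^ 2 : ℝ) : ℂ) := by
      simp [Matrix.trace, Matrix.mul_apply, Complex.conj_mul']
    rw [h2] at this
    refine Complex.ofReal_injective ?_
    rw [this]
    push_cast
    rfl
  have hle : ∀ i, √(h.eigenvalues i) ≤ 3 * a := by
    intro i
    have h1 : h.eigenvalues i ≤ (3 * a) ^ 2 := by
      calc h.eigenvalues i ≤ ∑ i, h.eigenvalues i :=
            Finset.single_le_sum (fun i _ => hnn i) (Finset.mem_univ i)
        _ = ∑ i, ∑ j, ‖A j i‖ ^ 2 := hsum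
        _ ≤ ∑ _i : Fin 3, ∑ _j : Fin 3, a ^ 2 := by
            gcongr with i _ j _
            exact hA j i
        _ = (3 * a) ^ 2 := by simp; ring
    exact Real.sqrt_le_iff.2 ⟨by positivity, h1⟩
  calc traceNorm A ≤ ∑ _i : Fin 3, 3 * a := Finset.sum_le_sum fun i _ => hle i
    _ = 9 * a := by simp; ring

/-! ### The evolution, the Gibbs states and the matrix X_σ -/

namespace Model

variable {M : Model}

lemma evolution_zero (σ lam : ℝ) : M.evolution σ lam 0 = 1 := by
  simp [evolution]

lemma hasDerivAt_evolution_mulVec (σ lam : ℝ) (v : Fin 3 × Fin 3 → ℂ) (p : Fin 3 × Fin 3) (t : ℝ) :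
    HasDerivAt (fun t => (M.evolution σ lam t).mulVec v p)
      (Complex.I * (M.totalLevelShift σ lam).mulVec ((M.evolution σ lam t).mulVec v) p) t := by
  let _ : NormedRing (Matrix (Fin 3 × Fin 3) (Fin 3 × Fin 3) ℂ) := Matrix.linftyOpNormedRing
  let _ : NormedAlgebra ℝ (Matrix (Fin 3 × Fin 3) (Fin 3 × Fin 3) ℂ) :=
    Matrix.linftyOpNormedAlgebra
  have h := hasDerivAt_exp_smul_const' (𝕂 := ℝ) (Complex.I • M.totalLevelShift σ lam) t
  let L : Matrix (Fin 3 × Fin 3) (Fin 3 × Fin 3) ℂ →ₗ[ℝ] ℂ :=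
    { toFun := fun A => A.mulVec v p
      map_add' := fun A B => by rw [Matrix.add_mulVec]; rfl
      map_smul' := fun c A => by rw [Matrix.smul_mulVec]; rfl }
  have h2 := (LinearMap.toContinuousLinearMap L).hasFDerivAt.comp_hasDerivAt t h
  have he : ∀ t : ℝ, NormedSpace.exp (t • Complex.I • M.totalLevelShift σ lam) =
      M.evolution σ lam t := fun t => by
    rw [evolution, mul_comm, mul_smul]
    rfl
  have hd : L ((Complex.I • M.totalLevelShift σ lam) *
      NormedSpace.exp (t • Complex.I • M.totalLevelShift σ lam)) =
      Complex.I * (M.totalLevelShift σ lam).mulVec ((M.evolution σ lam t).mulVec v) p := by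
    rw [he]
    change (((Complex.I • M.totalLevelShift σ lam) * M.evolution σ lam t).mulVec v) p = _
    rw [← Matrix.mulVec_mulVec, Matrix.smul_mulVec]
    rfl
  refine (h2.congr_deriv hd).congr_of_eventuallyEq (Eventually.of_forall fun t => ?_)
  change _ = L (NormedSpace.exp (t • Complex.I • M.totalLevelShift σ lam))
  rw [he]
  rfl

lemma exp_systemH (σ : ℝ) : NormedSpace.exp (-(M.β : ℂ) • M.systemH σ) =
    Matrix.diagonal fun j => (Real.exp (-M.β * M.levels σ j) : ℂ) := by
  rw [systemH, ← Matrix.diagonal_smul, Matrix.exp_diagonal]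
  congr 1
  funext j
  rw [Pi.coe_exp, ← Complex.exp_eq_exp_ℂ, Complex.ofReal_exp]
  simp

lemma trace_exp_systemH (σ : ℝ) : (NormedSpace.exp (-(M.β : ℂ) • M.systemH σ)).trace =
    ((∑ j, Real.exp (-M.β * M.levels σ j) : ℝ) : ℂ) := by
  rw [exp_systemH, Matrix.trace_diagonal, Complex.ofReal_sum]

lemma partitionFunction_eq (σ : ℝ) :
    M.partitionFunction σ = ∑ j, Real.exp (-M.β * M.levels σ j) := by
  rw [partitionFunction, trace_exp_systemH, Complex.ofReal_re]

lemma partitionFunction_pos (σ : ℝ) : 0 < M.partitionFunction σ := by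
  rw [partitionFunction_eq]
  exact Finset.sum_pos (fun j _ => Real.exp_pos _) Finset.univ_nonempty

lemma gibbs_eq (σ : ℝ) : M.gibbs σ =
    Matrix.diagonal fun j => ((Real.exp (-M.β * M.levels σ j) / M.partitionFunction σ : ℝ) : ℂ) := by
  rw [gibbs, trace_exp_systemH, exp_systemH, ← partitionFunction_eq, ← Matrix.diagonal_smul]
  congr 1
  funext j
  simp [div_eq_inv_mul]

/-- The detailed balance factor `exp(-βΔ)`. -/
def boltzmann (M : Model) : ℝ := Real.exp (-M.β * M.gap)

lemma partitionFunction_zero :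
    M.partitionFunction 0 = Real.exp (-M.β * M.E) * (M.boltzmann + 2) := by
  rw [partitionFunction_eq, boltzmann, mul_add, ← Real.exp_add]
  simp only [Fin.sum_univ_three, levels, gap]
  simp only [Matrix.cons_val_zero, Matrix.cons_val_one, Matrix.cons_val]
  ring_nf

/-- The diagonal entries of `X_σ`. -/
def gibbsRatioEntry (M : Model) (σ : ℝ) (j : Fin 3) : ℝ :=
  √(M.partitionFunction 0 / M.partitionFunction σ) *
    ![1, Real.exp (-M.β * σ / 4), Real.exp (M.β * σ / 4)] j

lemma gibbsRatio_eq (σ : ℝ) :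
    M.gibbsRatio σ = Matrix.diagonal fun j => (M.gibbsRatioEntry σ j : ℂ) := by
  rw [gibbsRatio, ← Matrix.diagonal_smul]
  congr 1
  funext j
  fin_cases j <;> simp [gibbsRatioEntry]

lemma gibbsRatioEntry_nonneg (σ : ℝ) (j : Fin 3) : 0 ≤ M.gibbsRatioEntry σ j := by
  rw [gibbsRatioEntry]
  refine mul_nonneg (Real.sqrt_nonneg _) ?_
  fin_cases j <;> simp [Real.exp_nonneg]

lemma partitionFunction_zero_le (σ : ℝ) : M.partitionFunction 0 ≤ M.partitionFunction σ := by
  rw [partitionFunction_zero, partitionFunction_eq]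
  have h1 : ∑ j, Real.exp (-M.β * M.levels σ j) = Real.exp (-M.β * M.E) *
      (M.boltzmann + (Real.exp (M.β * σ / 2) + Real.exp (-(M.β * σ / 2)))) := by
    rw [boltzmann]
    simp only [mul_add, ← Real.exp_add, Fin.sum_univ_three, levels, gap]
    simp only [Matrix.cons_val_zero, Matrix.cons_val_one, Matrix.cons_val]
    ring_nf
  rw [h1]
  gcongr
  have := Real.one_le_cosh (M.β * σ / 2)
  rw [Real.cosh_eq] at this
  linarith

/-- A bound uniform in σ, needed for a constant C independent of σ; Z_0 ≤ Z_σ takes care of the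
prefactor. -/
lemma gibbsRatioEntry_le (hβ : 0 < M.β) {σ : ℝ} (hσ : 0 < σ) (hσ1 : σ ≤ 1) (j : Fin 3) :
    M.gibbsRatioEntry σ j ≤ Real.exp (M.β / 4) := by
  have h1 : √(M.partitionFunction 0 / M.partitionFunction σ) ≤ 1 :=
    Real.sqrt_le_one.2 ((div_le_one (partitionFunction_pos σ)).2 (partitionFunction_zero_le σ))
  have h2 : ![1, Real.exp (-M.β * σ / 4), Real.exp (M.β * σ / 4)] j ≤ Real.exp (M.β / 4) := by
    have h3 : M.β * σ ≤ M.β := by nlinarith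
    have h4 := mul_pos hβ hσ
    fin_cases j
    · exact Real.one_le_exp (by positivity)
    · exact Real.exp_le_exp.2 (by linarith)
    · exact Real.exp_le_exp.2 (by linarith)
  rw [gibbsRatioEntry]
  calc _ ≤ √(M.partitionFunction 0 / M.partitionFunction σ) * Real.exp (M.β / 4) := by gcongr
    _ ≤ 1 * Real.exp (M.β / 4) := by gcongr
    _ = _ := one_mul _

/-- The weights of the Gibbs state at `σ = 0`, up to normalisation. -/
def gibbsWeight (M : Model) : Fin 3 → ℝ := ![M.boltzmann, 1, 1]

/-- The identity X_σ ρ_{S,β,0} X_σ = ρ_{S,β,σ} on the diagonal, by which the limit at σ = 0 becomes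
the Gibbs state at σ. -/
lemma gibbs_weight_eq (σ : ℝ) (j : Fin 3) :
    Real.exp (-M.β * M.levels σ j) / M.partitionFunction σ =
      M.gibbsRatioEntry σ j ^ 2 * M.gibbsWeight j / (M.boltzmann + 2) := by
  have hZ := M.partitionFunction_pos σ
  have hb : 0 < M.boltzmann := Real.exp_pos _
  rw [gibbsRatioEntry, mul_pow, Real.sq_sqrt (div_pos (partitionFunction_pos 0) hZ).le,
    partitionFunction_zero]
  field_simp
  fin_cases j
  · simp [gibbsWeight, boltzmann, levels, gap, ← Real.exp_add]
    ring
  · simp [gibbsWeight, levels, ← Real.exp_add, ← Real.exp_nat_mul]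
    ring
  · simp [gibbsWeight, levels, ← Real.exp_add, ← Real.exp_nat_mul]
    ring

/-- The observable that reads off the matrix element `(k, l)` of `T_t(ρ)`. -/
lemma gibbsRatio_mul_single_mul (σ : ℝ) (l k i j : Fin 3) :
    (M.gibbsRatio σ * Matrix.single l k 1 * M.gibbsRatio σ : Matrix (Fin 3) (Fin 3) ℂ) i j =
      if i = l ∧ j = k then ((M.gibbsRatioEntry σ l * M.gibbsRatioEntry σ k : ℝ) : ℂ) else 0 := by
  rw [gibbsRatio_eq, Matrix.mul_diagonal, Matrix.diagonal_mul, Matrix.single_apply]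
  by_cases h : i = l ∧ j = k
  · obtain ⟨rfl, rfl⟩ := h
    simp
  · rw [if_neg h, if_neg (fun h' => h ⟨h'.1.symm, h'.2.symm⟩)]
    simp


/-! ### Relaxation of observables and of states -/

/-- Relaxation of the Heisenberg evolution to the expectation in the Gibbs state at `σ = 0`. -/
lemma exists_heisenberg_decay {γ q x y : ℝ} (hγ : 0 < γ) (hq : 0 < q)
    (hgen : M.IsGenerator γ q x y) :
    ∃ κ > 0, κ ≤ 1 ∧ ∃ C > 0, ∃ c > 0, ∀ lam σ : ℝ, 0 < |lam| → 0 < σ → σ < κ * lam ^ 2 →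
      ∀ (A : Matrix (Fin 3) (Fin 3) ℂ) (B : ℝ), (∀ i j, ‖A i j‖ ≤ B) → ∀ t, 0 ≤ t → ∀ i j,
        ‖M.heisenberg σ lam t A i j -
          (if i = j then (q * A 0 0 + A 1 1 + A 2 2) / (q + 2) else 0)‖ ≤
          C * B * Real.exp (-c * t * σ ^ 2 / lam ^ 2) := by
  obtain ⟨κ, hκ, hκ1, C, hC, c, hc, hdec⟩ := exists_decay hγ hq y
  refine ⟨κ, hκ, hκ1, C + 2, by positivity, min c (2 * γ), by positivity, ?_⟩
  intro lam σ hlam hσ hσκ A B hA t ht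
  have hlam2 : 0 < lam ^ 2 := by rw [← sq_abs]; positivity
  have hB : 0 ≤ B := (norm_nonneg _).trans (hA 0 0)
  let u : Fin 3 × Fin 3 → ℝ → ℂ := fun p t =>
    (M.evolution σ lam t).mulVec (fun p => A p.1 p.2) p
  have hu : ∀ p t, HasDerivAt (u p) _ t := fun p t =>
    hasDerivAt_evolution_mulVec σ lam (fun p => A p.1 p.2) p t
  have hu0 : ∀ p, u p 0 = A p.1 p.2 := fun p => by
    simp only [u, evolution_zero, Matrix.one_mulVec]
  have hG := fun t => hgen σ lam (fun p => u p t)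
  simp only at hG
  have hexp₁ : Real.exp (-c * t * σ ^ 2 / lam ^ 2) ≤
      Real.exp (-min c (2 * γ) * t * σ ^ 2 / lam ^ 2) := by
    have : min c (2 * γ) ≤ c := min_le_left _ _
    gcongr
  -- Since κ ≤ 1, σ ≤ λ², so the coherence rate 2γλ² is at least 2γσ²/λ².
  have hσ2 : σ ^ 2 / lam ^ 2 ≤ lam ^ 2 := by
    rw [div_le_iff₀ hlam2]
    have : σ ≤ lam ^ 2 := by nlinarith
    nlinarith
  have hexp₂ : Real.exp (-(2 * γ * lam ^ 2) * t) ≤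
      Real.exp (-min c (2 * γ) * t * σ ^ 2 / lam ^ 2) := by
    rw [Real.exp_le_exp]
    have h1 : min c (2 * γ) * t * (σ ^ 2 / lam ^ 2) ≤ 2 * γ * t * lam ^ 2 := by
      gcongr
      exact min_le_right _ _
    have h2 : -min c (2 * γ) * t * σ ^ 2 / lam ^ 2 = -(min c (2 * γ) * t * (σ ^ 2 / lam ^ 2)) := by
      ring
    rw [h2]
    linarith
  obtain ⟨d00, d11, d22, d12, d21⟩ := hdec (lam ^ 2) σ hlam2 hσ hσκ
    (u (0, 0)) (u (1, 1)) (u (1, 2)) (u (2, 1)) (u (2, 2))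
    (fun t => (hu _ t).congr_deriv ((hG t).1.trans (by push_cast; ring)))
    (fun t => (hu _ t).congr_deriv ((hG t).2.1.trans (by push_cast; ring)))
    (fun t => (hu _ t).congr_deriv ((hG t).2.2.1.trans (by push_cast; ring)))
    (fun t => (hu _ t).congr_deriv ((hG t).2.2.2.1.trans (by push_cast; ring)))
    (fun t => (hu _ t).congr_deriv ((hG t).2.2.2.2.1.trans (by push_cast; ring)))
    B (by rw [hu0]; exact hA _ _) (by rw [hu0]; exact hA _ _) (by rw [hu0]; exact hA _ _)
    (by rw [hu0]; exact hA _ _) (by rw [hu0]; exact hA _ _) t ht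
  simp only [hu0] at d00 d11 d22 d12 d21
  have hqγ : 0 ≤ q * γ := by positivity
  have d01 := norm_le_of_coherence_equation (f := u (0, 1)) (g := u (0, 2))
    (a := M.gap - σ / 2) (b := M.gap + σ / 2) (x := -2 * x) (y := y) (γ := γ) (r := q * γ)
    (μ := lam ^ 2) hqγ hlam2
    (fun t => (hu _ t).congr_deriv ((hG t).2.2.2.2.2.1.trans (by push_cast; ring)))
    (fun t => (hu _ t).congr_deriv ((hG t).2.2.2.2.2.2.1.trans (by push_cast; ring))) ht
  have d02 := norm_le_of_coherence_equation (f := u (0, 2)) (g := u (0, 1))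
    (b := M.gap - σ / 2) (a := M.gap + σ / 2) (x := -2 * x) (y := y) (γ := γ) (r := q * γ)
    (μ := lam ^ 2) hqγ hlam2
    (fun t => (hu _ t).congr_deriv ((hG t).2.2.2.2.2.2.1.trans (by push_cast; ring)))
    (fun t => (hu _ t).congr_deriv ((hG t).2.2.2.2.2.1.trans (by push_cast; ring))) ht
  have d10 := norm_le_of_coherence_equation (f := u (1, 0)) (g := u (2, 0))
    (a := -(M.gap - σ / 2)) (b := -(M.gap + σ / 2)) (x := 2 * x) (y := -y) (γ := γ) (r := q * γ)
    (μ := lam ^ 2) hqγ hlam2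
    (fun t => (hu _ t).congr_deriv ((hG t).2.2.2.2.2.2.2.1.trans (by push_cast; ring)))
    (fun t => (hu _ t).congr_deriv ((hG t).2.2.2.2.2.2.2.2.trans (by push_cast; ring))) ht
  have d20 := norm_le_of_coherence_equation (f := u (2, 0)) (g := u (1, 0))
    (b := -(M.gap - σ / 2)) (a := -(M.gap + σ / 2)) (x := 2 * x) (y := -y) (γ := γ) (r := q * γ)
    (μ := lam ^ 2) hqγ hlam2
    (fun t => (hu _ t).congr_deriv ((hG t).2.2.2.2.2.2.2.2.trans (by push_cast; ring)))
    (fun t => (hu _ t).congr_deriv ((hG t).2.2.2.2.2.2.2.1.trans (by push_cast; ring))) ht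
  simp only [hu0] at d01 d02 d10 d20
  set E := Real.exp (-min c (2 * γ) * t * σ ^ 2 / lam ^ 2)
  have hE : 0 ≤ E := Real.exp_nonneg _
  have hfast : ∀ {w : ℂ}, ‖w‖ ≤ C * B * Real.exp (-c * t * σ ^ 2 / lam ^ 2) →
      ‖w‖ ≤ (C + 2) * B * E := fun h => h.trans (by gcongr; linarith)
  have hcoh : ∀ {w : ℂ} {i j k l}, ‖w‖ ≤ (‖A i j‖ + ‖A k l‖) *
      Real.exp (-(2 * γ * lam ^ 2) * t) → ‖w - 0‖ ≤ (C + 2) * B * E := by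
    intro w i j k l h
    rw [sub_zero]
    have h1 : ‖A i j‖ + ‖A k l‖ ≤ (C + 2) * B := by
      have := mul_nonneg hC.le hB
      linarith [hA i j, hA k l]
    exact h.trans (by gcongr)
  intro i j
  fin_cases i <;> fin_cases j
  · exact hfast d00
  · exact hcoh d01
  · exact hcoh d02
  · exact hcoh d10
  · exact hfast d11
  · exact hfast (w := u (1, 2) t - 0) (by rwa [sub_zero])
  · exact hcoh d20
  · exact hfast (w := u (2, 1) t - 0) (by rwa [sub_zero])
  · exact hfast d22

/-- Entrywise relaxation of the approximate reduced dynamics to the Gibbs state. -/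
lemma exists_approxDynamics_decay (hβ : 0 < M.β) {γ x y : ℝ} (hγ : 0 < γ)
    (hgen : M.IsGenerator γ M.boltzmann x y) :
    ∃ κ > 0, ∃ C > 0, ∃ c > 0, ∀ lam : ℝ, 0 < |lam| → |lam| < 1 → ∀ σ : ℝ, 0 < σ →
      σ < κ * lam ^ 2 → ∀ ρ : Matrix (Fin 3) (Fin 3) ℂ, IsDensityMatrix ρ → ∀ t, 0 ≤ t → ∀ k l,
        ‖M.approxDynamics σ lam t ρ k l - M.gibbs σ k l‖ ≤
          C * Real.exp (-c * t * σ ^ 2 / lam ^ 2) := by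
  have hq : 0 < M.boltzmann := Real.exp_pos _
  obtain ⟨κ, hκ, hκ1, C, hC, c, hc, hdec⟩ := exists_heisenberg_decay hγ hq hgen
  refine ⟨κ, hκ, 9 * (C * Real.exp (M.β / 4) ^ 2), by positivity, c, hc, ?_⟩
  intro lam hlam hlam1 σ hσ hσκ ρ hρ t ht k l
  -- Here |λ| < 1 and κ ≤ 1 bound σ, and with it the entries of X_σ.
  have hσ1 : σ ≤ 1 := by
    have h1 : lam ^ 2 ≤ 1 := by
      rw [← sq_abs]
      nlinarith
    nlinarith [sq_nonneg lam]
  set A : Matrix (Fin 3) (Fin 3) ℂ := M.gibbsRatio σ * Matrix.single l k 1 * M.gibbsRatio σ with hA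
  have hAe : ∀ i j, A i j = _ := fun i j => gibbsRatio_mul_single_mul σ l k i j
  have hAB : ∀ i j, ‖A i j‖ ≤ Real.exp (M.β / 4) ^ 2 := by
    intro i j
    rw [hAe]
    split_ifs
    · have h1 := M.gibbsRatioEntry_nonneg σ l
      have h2 := M.gibbsRatioEntry_nonneg σ k
      rw [Complex.norm_real, Real.norm_of_nonneg (mul_nonneg h1 h2), sq]
      gcongr <;> exact gibbsRatioEntry_le hβ hσ hσ1 _
    · rw [norm_zero]
      positivity
  set m : ℂ := (M.boltzmann * A 0 0 + A 1 1 + A 2 2) / (M.boltzmann + 2) with hm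
  have hgibbs : M.gibbs σ k l = m := by
    rw [gibbs_eq, Matrix.diagonal_apply, gibbs_weight_eq, hm]
    simp only [hAe]
    by_cases hkl : k = l
    · subst hkl
      fin_cases k <;> simp [gibbsWeight] <;> ring
    · rw [if_neg hkl]
      fin_cases k <;> fin_cases l <;> simp at hkl ⊢
  -- The limit of the observable is m times the identity, whose expectation in ρ is m because ρ has
  -- trace one.
  have hdiff : M.approxDynamics σ lam t ρ k l - M.gibbs σ k l =
      ∑ i, ∑ j, ρ i j * (M.heisenberg σ lam t A j i - if j = i then m else 0) := by
    have h1 : ∑ i, ∑ j, ρ i j * (if j = i then m else 0) = m := by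
      have h2 : ∑ i, ρ i i = 1 := hρ.2
      simp only [mul_ite, mul_zero, Finset.sum_ite_eq', Finset.mem_univ, if_true,
        ← Finset.sum_mul, h2, one_mul]
    simp only [mul_sub, Finset.sum_sub_distrib]
    rw [h1, hgibbs]
    rfl
  rw [hdiff]
  have hb : ∀ i j, ‖ρ i j * (M.heisenberg σ lam t A j i - if j = i then m else 0)‖ ≤
      C * Real.exp (M.β / 4) ^ 2 * Real.exp (-c * t * σ ^ 2 / lam ^ 2) := by
    intro i j
    rw [norm_mul]
    have h1 := hdec lam σ hlam hσ hσκ A _ hAB t ht j i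
    calc _ ≤ 1 * (C * Real.exp (M.β / 4) ^ 2 * Real.exp (-c * t * σ ^ 2 / lam ^ 2)) := by
          gcongr
          exact hρ.norm_apply_le_one i j
      _ = _ := one_mul _
  calc _ ≤ ∑ _i : Fin 3, ∑ _j : Fin 3,
        C * Real.exp (M.β / 4) ^ 2 * Real.exp (-c * t * σ ^ 2 / lam ^ 2) :=
        norm_sum_le_of_le _ fun i _ => norm_sum_le_of_le _ fun j _ => hb i j
    _ = _ := by simp; ring

end Model

end ThreeLevel

end

/-! ### The unique final state -/

theorem proposition4 (M : ThreeLevel.Model) (hgap : M.E < M.E₀) (hβ : 0 < M.β)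
    (hg : MemLp M.g 2 (volume : Measure (EuclideanSpace ℝ (Fin 3))))
    (hreg : DifferentiableAt ℝ M.spectralDensity M.gap)
    (hJ : 0 < M.spectralDensity M.gap)
    (J₀ : ℝ) (hJ₀lim : Tendsto (fun ω : ℝ => M.spectralDensity ω / ω) (𝓝[>] 0) (𝓝 J₀))
    (hJ₀ : 0 < J₀) :
    (∀ σ lam e : ℝ, (e = 0 ∨ e = M.gap ∨ e = -M.gap) →
      Tendsto (fun ε : ℝ => M.levelShiftReg σ lam e ε) (𝓝[>] 0) (𝓝 (M.levelShift σ lam e))) ∧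
    ∃ lam₀ > 0, ∃ κ > 0, ∃ C > 0, ∃ c > 0,
      ∀ lam : ℝ, 0 < |lam| → |lam| < lam₀ → ∀ σ : ℝ, 0 < σ → σ < κ * lam ^ 2 →
        ∀ ρ : Matrix (Fin 3) (Fin 3) ℂ, ThreeLevel.IsDensityMatrix ρ →
          Tendsto (fun t : ℝ => M.approxDynamics σ lam t ρ) atTop (𝓝 (M.gibbs σ)) ∧
          ∀ t : ℝ, 0 ≤ t →
            ThreeLevel.traceNorm (M.approxDynamics σ lam t ρ - M.gibbs σ) ≤
              C * Real.exp (-c * t * σ ^ 2 / lam ^ 2) := by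
  have hgap' : 0 < M.gap := sub_pos.2 hgap
  obtain ⟨x, y, hx, hy⟩ :=
    M.exists_tendsto_cauchyTransform_thermalDensity hgap' hβ hg hreg hJ₀lim
  -- Only the values at ±Δ matter; away from Δ the function is set to the value required at -Δ.
  let F : ℝ → ℂ := fun a => if a = M.gap then 2 * ((x : ℂ) - Complex.I * M.rate)
    else 2 * ((y : ℂ) - Complex.I * (M.boltzmann * M.rate))
  have hne : -M.gap ≠ M.gap := by linarith
  have hF₁ : F M.gap = 2 * ((x : ℂ) - Complex.I * M.rate) := if_pos rfl
  have hF₂ : F (-M.gap) = 2 * ((y : ℂ) - Complex.I * (M.boltzmann * M.rate)) := if_neg hne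
  have hlim := M.tendsto_levelShiftReg hβ hg hJ₀lim (F := F) (by rwa [hF₁])
    (by
      rw [hF₂, ThreeLevel.Model.boltzmann]
      rwa [Complex.ofReal_mul] at hy)
  have hΛ : ∀ σ lam e, M.levelShift σ lam e = M.shiftEntry F σ lam e := fun σ lam e =>
    (hlim σ lam e).limUnder_eq
  refine ⟨fun σ lam e _ => by rw [hΛ]; exact hlim σ lam e, ?_⟩
  have hgen := M.isGenerator_of_boundary_values hgap' hF₁ hF₂ hΛ
  obtain ⟨κ, hκ, C, hC, c, hc, hdec⟩ :=
    M.exists_approxDynamics_decay hβ (M.rate_pos hgap' hβ hJ) hgen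
  refine ⟨1, one_pos, κ, hκ, 9 * C, by positivity, c, hc, ?_⟩
  intro lam hlam hlam1 σ hσ hσκ ρ hρ
  have hd := hdec lam hlam hlam1 σ hσ hσκ ρ hρ
  have hlam2 : 0 < lam ^ 2 := by rw [← sq_abs]; positivity
  constructor
  · refine tendsto_pi_nhds.2 fun k => tendsto_pi_nhds.2 fun l => ?_
    rw [tendsto_iff_norm_sub_tendsto_zero]
    refine squeeze_zero' (Eventually.of_forall fun t => norm_nonneg _)
      ((eventually_ge_atTop 0).mono fun t ht => hd t ht k l) ?_
    have h1 : Tendsto (fun t : ℝ => -(c * σ ^ 2 / lam ^ 2 * t)) atTop atBot :=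
      tendsto_neg_atTop_atBot.comp (tendsto_id.const_mul_atTop (by positivity))
    have h2 := (Real.tendsto_exp_atBot.comp h1).const_mul C
    rw [mul_zero] at h2
    refine h2.congr fun t => ?_
    simp only [Function.comp_apply]
    congr 2
    ring
  · intro t ht
    refine (ThreeLevel.traceNorm_le_of_norm_apply_le fun k l => hd t ht k l).trans ?_
    exact (mul_assoc 9 C _).symm.le
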